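/- **Definitions.** All sets are finite. A *hypergraph* is a finite family $H$ of finite nonempty sets; its *carrier* is $\bigcup H$ (the empty family is allowed). $H$ is *atomic* if $\{x\}\in H$ for every $x\in\bigcup H$. For $Y\subseteq\bigcup H$ put $H_Y=\{X\in H\mid X\subseteq Y\}$. A *hypergraph partition* of $H$ is a partition $\{H_1,\dots,H_n\}$ of $H$ such that the sets $\bigcup H_1,\dots,\bigcup H_n$ are nonempty, pairwise disjoint and have union $\bigcup H$ (for $H=\emptyset$ this is the empty partition, $n=0$). $H$ is *connected* if it has exactly one hypergraph partition. The *finest* hypergraph partition of $H$ is the one all of whose members are connected; its members are the *connected components* of $H$, and their number $n$ is the *connectedness number* of $H$ (it is $0$ for $H=\emptyset$). The *constructions* of an atomic hypergraph $H$ are defined by induction on $|\bigcup H|$: (0) $\emptyset$ is the only construction of $\emptyset$; (1) if $|\bigcup H|\ge 1$, $H$ is connected, $x\in\bigcup H$ and $K$ is a construction of $H_{\bigcup H-\{x\}}$, then $K\cup\{\bigcup H\}$ is a construction of $H$; (2) if $|\bigcup H|\ge 2$, $H$ is not connected, $H_1,\dots,H_n$ are its connected components and $K_i$ is a construction of $H_i$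 for each $i$, then $K_1\cup\dots\cup K_n$ is a construction of $H$. A *construct* of $H$ is a subfamily of a construction of $H$ that contains $\bigcup H_i$ for every connected component $H_i$ of $H$. A set $Y\subseteq\bigcup H$ is *dispensable* in a hypergraph $H$ if $H_Y-\{Y\}$ is a connected hypergraph with carrier $Y$. *Cognation* is the equivalence relation on hypergraphs generated by relating $H$ to the hypergraph $H\cup\{Y\}$ whenever $Y\notin H$ is nonempty and dispensable in $H$. The *saturated closure* $\bar H$ of $H$ is the union of all hypergraphs cognate to $H$. The partially ordered set $\mathcal A(H)$ has as its elements (*faces*) all constructs of $H$ and, in addition, the set $\bar H\cup\{*\}$, where $*$ is a new object; it is ordered by reverse inclusion, $C_1\le C_2$ iff $C_2\subseteq C_1$. An *abstract polytope of rank* $r$ (in the sense of McMullen and Schulte), for an integer $r\ge-1$, is a partially ordered set $P$ such that: - (P1) $P$ has a least face $F_{-1}$ and a greatest face $F_r$. - (P2) Every flag (maximal linearly ordered subset) of $P$ has exactly $r+2$ faces. A partially ordered set satisfying (P1) and (P2) is called *of rank* $r$. - (P3) For all faces $F\le G$ the section $G/F=\{X\in P\mid F\le X\le G\}$ is a connected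 partially ordered set of some rank $r'\le r$. Here a partially ordered set of rank $r'$ is *connected* if $r'\le 1$, or any two of its proper faces (those different from its least and its greatest face) are joined by a finite sequence of proper faces in which consecutive faces are comparable. - (P4) For every $i\in\{0,\dots,r-1\}$ and all faces $F\le G$ of ranks $i-1$ and $i+1$ respectively, there are exactly two faces $X$ of rank $i$ with $F\le X\le G$. Here the *rank* of a face $F$ is the rank of the section $F/F_{-1}$. **Proposition 8.3.** For every atomic hypergraph $H$, the partially ordered set $\mathcal A(H)$ is an abstract polytope of rank $|\bigcup H|-n$, where $n$ is the connectedness number of $H$. -/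

import Mathlib

namespace HypergraphPolytope

universe u

section Hypergraphs

variable {α : Type u} [DecidableEq α]

/-- The carrier `⋃ H` of a finite family `H` of finite sets. -/
def carrier (H : Finset (Finset α)) : Finset α := H.sup id

/-- A finite family of finite sets is a hypergraph (on its union) when the empty set is not
a member of it. The empty family is allowed. -/
def IsHypergraph (H : Finset (Finset α)) : Prop := ∅ ∉ H

/-- `H` is a hypergraph on `C`. -/
def IsHypergraphOn (H : Finset (Finset α)) (C : Finset α) : Prop :=
  IsHypergraph H ∧ carrier H = C

/-- A hypergraph is atomic when `{x} ∈ H` for every `x` in its carrier. -/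
def IsAtomic (H : Finset (Finset α)) : Prop := ∀ x ∈ carrier H, {x} ∈ H

/-- `H_Y`: the members of `H` that are subsets of `Y`. -/
def restrict (H : Finset (Finset α)) (Y : Finset α) : Finset (Finset α) :=
  H.filter (fun X => X ⊆ Y)

/-- A partition `{H₁, …, Hₙ}` of `H` is a hypergraph partition when the carriers
`⋃ H₁, …, ⋃ Hₙ` partition `⋃ H`, i.e. they are nonempty, disjoint for distinct `Hᵢ`, `Hⱼ`,
and their union is `⋃ H`. For `H = ∅` the only partition is the empty one. -/
structure IsHypergraphPartition {H : Finset (Finset α)} (P : Finpartition H) : Prop where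
  carrier_nonempty : ∀ J ∈ P.parts, (carrier J).Nonempty
  carrier_disjoint : ∀ J₁ ∈ P.parts, ∀ J₂ ∈ P.parts, J₁ ≠ J₂ →
    Disjoint (carrier J₁) (carrier J₂)
  carrier_union : P.parts.sup carrier = carrier H

/-- A hypergraph is connected when it has only one hypergraph partition. -/
def Connected (H : Finset (Finset α)) : Prop :=
  ∃! P : Finpartition H, IsHypergraphPartition P

/-- The finest hypergraph partition of `H`: the one all of whose members are connected. -/
def IsFinest {H : Finset (Finset α)} (P : Finpartition H) : Prop :=
  IsHypergraphPartition P ∧ ∀ J ∈ P.parts, Connected J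

open Classical in
/-- The connected components of `H`: the members of the finest hypergraph partition of `H`. -/
noncomputable def components (H : Finset (Finset α)) : Finset (Finset (Finset α)) :=
  H.powerset.filter (fun J => ∃ P : Finpartition H, IsFinest P ∧ J ∈ P.parts)

/-- The connectedness number of `H`: the number of its connected components. -/
noncomputable def connectednessNumber (H : Finset (Finset α)) : ℕ := (components H).card

/-- `IsConstruction H K`: the family `K` is a construction of the atomic hypergraph `H`. -/
inductive IsConstruction : Finset (Finset α) → Finset (Finset α) → Prop
  | empty : IsConstruction ∅ ∅
  | connected {H K : Finset (Finset α)} {x : α} (hH : Connected H) (hx : x ∈ carrier H)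
      (hK : IsConstruction (restrict H (carrier H \ {x})) K) :
      IsConstruction H (K ∪ {carrier H})
  | disconnected {H : Finset (Finset α)} (hcard : 2 ≤ (carrier H).card) (hH : ¬ Connected H)
      (K : Finset (Finset α) → Finset (Finset α))
      (hK : ∀ J ∈ components H, IsConstruction J (K J)) :
      IsConstruction H ((components H).biUnion K)

/-- A construct of `H` is a subfamily of a construction of `H` that contains the carrier of
every connected component of `H`. -/
def IsConstruct (H C : Finset (Finset α)) : Prop :=
  (∃ K, IsConstruction H K ∧ C ⊆ K) ∧ ∀ J ∈ components H, carrier J ∈ C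

/-- `Y ⊆ ⋃ H` is dispensable in `H` when `H_Y - {Y}` is a connected hypergraph on `Y`. -/
def Dispensable (H : Finset (Finset α)) (Y : Finset α) : Prop :=
  Y ⊆ carrier H ∧ IsHypergraphOn (restrict H Y \ {Y}) Y ∧ Connected (restrict H Y \ {Y})

/-- The hypergraph `J` enhances the hypergraph `H`: it is `H ∪ {Y}` with `Y ∉ H` dispensable
in `H`. -/
def Enhances (H J : Finset (Finset α)) : Prop :=
  IsHypergraph H ∧ IsHypergraph J ∧ ∃ Y, Dispensable H Y ∧ Y ∉ H ∧ J = H ∪ {Y}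

/-- Cognation: the reflexive, symmetric and transitive closure of enhancement. -/
def Cognate (H J : Finset (Finset α)) : Prop := Relation.EqvGen Enhances H J

open Classical in
/-- The saturated closure of `H`: the greatest hypergraph cognate to `H`, i.e. the union of
all hypergraphs cognate to `H` (they all have the carrier of `H`). -/
noncomputable def saturatedClosure (H : Finset (Finset α)) : Finset (Finset α) :=
  (carrier H).powerset.filter (fun Y => ∃ J, Cognate H J ∧ Y ∈ J)

/-- A face of the abstract polytope of `H` is either a construct of `H`, or the saturated
closure of `H` together with one new element `*`. To have room for `*`, sets `X` are written
as `some X`, and `*` is `none`. -/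
def IsFace (H : Finset (Finset α)) (F : Finset (Option (Finset α))) : Prop :=
  (∃ C, IsConstruct H C ∧ F = C.map Function.Embedding.some) ∨
    F = Finset.insertNone (saturatedClosure H)

/-- The carrier of the abstract polytope of `H`: the type of its faces. -/
@[ext]
structure FacePoset (H : Finset (Finset α)) : Type u where
  face : Finset (Option (Finset α))
  isFace : IsFace H face

/-- Faces are ordered by reverse inclusion. -/
instance FacePoset.instPartialOrder (H : Finset (Finset α)) : PartialOrder (FacePoset H) where
  le F G := G.face ⊆ F.face
  le_refl F := Finset.Subset.refl F.face
  le_trans _ _ _ h₁ h₂ := Finset.Subset.trans h₂ h₁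
  le_antisymm _ _ h₁ h₂ := FacePoset.ext (Finset.Subset.antisymm h₂ h₁)

end Hypergraphs

section Polytopes

/-- `P` is a partially ordered set of rank `r ≥ -1`: it has a least and a greatest face, and
every flag (maximal chain) has exactly `r + 2` faces. -/
structure IsPosetOfRank (P : Type u) [PartialOrder P] (r : ℤ) : Prop where
  neg_one_le : -1 ≤ r
  exists_least : ∃ a : P, IsBot a
  exists_greatest : ∃ b : P, IsTop b
  flag_card : ∀ s : Flag P, (s : Set P).Finite ∧ ((s : Set P).ncard : ℤ) = r + 2

/-- A face is proper when it is neither the least nor the greatest face. -/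
def IsProper {P : Type u} [PartialOrder P] (F : P) : Prop := ¬ IsBot F ∧ ¬ IsTop F

/-- Two faces are incident when they are comparable. -/
def Incident {P : Type u} [PartialOrder P] (F G : P) : Prop := F ≤ G ∨ G ≤ F

/-- Connectedness of a partially ordered set of rank `r`: either `r ≤ 1`, or any two proper
faces are joined by a finite sequence of consecutively incident proper faces. -/
def IsConnectedOfRank (P : Type u) [PartialOrder P] (r : ℤ) : Prop :=
  r ≤ 1 ∨ ∀ F G : {F : P // IsProper F},
    Relation.ReflTransGen (fun A B : {F : P // IsProper F} => Incident A.1 B.1) F G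

/-- The face `F` has rank `k` when the section `F / F₋₁`, where `F₋₁` is the least face, is a
partially ordered set of rank `k`. -/
def HasFaceRank {P : Type u} [PartialOrder P] (F : P) (k : ℤ) : Prop :=
  ∃ a : P, IsBot a ∧ IsPosetOfRank (Set.Icc a F) k

/-- Abstract polytopes of rank `r` in the sense of McMullen and Schulte. -/
structure IsAbstractPolytope (P : Type u) [PartialOrder P] (r : ℤ) : Prop where
  /-- `P` is bounded, and its flags have exactly `r + 2` faces. -/
  rank : IsPosetOfRank P r
  /-- `P` is strongly connected: every section is a connected partially ordered set of some
  rank `r' ≤ r`. -/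
  strongly_connected : ∀ F G : P, F ≤ G → ∃ r' : ℤ, r' ≤ r ∧
    IsPosetOfRank (Set.Icc F G) r' ∧ IsConnectedOfRank (Set.Icc F G) r'
  /-- The diamond condition: between incident faces of ranks `i - 1` and `i + 1` there are
  exactly two faces of rank `i`. -/
  diamond : ∀ i : ℤ, 0 ≤ i → i ≤ r - 1 → ∀ F G : P,
    HasFaceRank F (i - 1) → HasFaceRank G (i + 1) → F ≤ G →
      {X : P | HasFaceRank X i ∧ F ≤ X ∧ X ≤ G}.ncard = 2

end Polytopes

end HypergraphPolytope

/-! Call a nonempty `Y` a tube when `H_Y` is connected. The tubes form a building set on `V = ⋃ H`,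
and the constructs are exactly the nested sets of tubes that contain all maximal tubes
(`isConstruct_iff`); the constructions are those with `|V|` members.

Nested sets are controlled by labels: the label of a member `S` of `N` consists of the points of `S`
lying in no smaller member. Labels are nonempty and partition `V`, so `|N| ≤ |V|`. If `x` is a label
of `S`, every component of `S \ {x}` can be added to `N` (`Nested.insert_component`). Hence every
nested set extends to one with `|V|` members, one that lacks a single member has exactly two
completions (`exists_two_completions`), and links of codimension at least two are connected
(`link_connected`).

The rank `|V| - |C|` of a construct `C`, with `-1` for the least face, grades the poset. A section
between two constructs is a Boolean lattice, and a section above the least face is governed by a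
link in the nested set complex; connectedness and the diamond condition follow. The greatest face is
the set of the `n` maximal tubes, which gives rank `|V| - n`. -/

namespace HypergraphPolytope

universe u

/-! ### Building sets, nested sets and their labels. -/

section BuildingSets

variable {α : Type u} [DecidableEq α] {B N : Finset (Finset α)} {V Y S T U W : Finset α} {x y : α}

/-- A building set on `V`: a family of nonempty subsets of `V` which contains all singletons and is
closed under unions of two intersecting members. -/
structure IsBuildingSet (B : Finset (Finset α)) (V : Finset α) : Prop where
  nonempty : ∀ {S}, S ∈ B → S.Nonempty
  subset : ∀ {S}, S ∈ B → S ⊆ V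
  singleton : ∀ {x}, x ∈ V → {x} ∈ B
  union : ∀ {S T}, S ∈ B → T ∈ B → ¬ Disjoint S T → S ∪ T ∈ B

/-- `T` is a maximal member of `B` below `Y`. -/
def IsComponent (B : Finset (Finset α)) (Y T : Finset α) : Prop :=
  T ∈ B ∧ T ⊆ Y ∧ ∀ W ∈ B, W ⊆ Y → ¬ Disjoint W T → W ⊆ T

/-- Nested sets: subfamilies of `B` in which no union of members is a member of `B`,
except for the trivial ones. -/
def Nested (B N : Finset (Finset α)) : Prop :=
  N ⊆ B ∧ ∀ M ⊆ N, M.sup id ∈ B → M.sup id ∈ M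

/-- A nested set which contains all maximal members of the building set `B` on `V`. -/
def SpanningNested (B : Finset (Finset α)) (V : Finset α) (N : Finset (Finset α)) : Prop :=
  Nested B N ∧ ∀ T, IsComponent B V T → T ∈ N

/-- The elements of `S` which are not in a smaller member of `N`. -/
def label (N : Finset (Finset α)) (S : Finset α) : Finset α :=
  S.filter (fun x => ∀ U ∈ N, U ⊂ S → x ∉ U)

theorem mem_label : x ∈ label N S ↔ x ∈ S ∧ ∀ U ∈ N, U ⊂ S → x ∉ U := by
  simp [label]

omit [DecidableEq α] in
theorem not_disjoint_of_mem (hS : x ∈ S) (hT : x ∈ T) : ¬ Disjoint S T :=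
  Finset.not_disjoint_iff.2 ⟨x, hS, hT⟩

/-- A largest member between `S` and `Y` absorbs every member that meets it, since their union is
again a candidate. -/
theorem IsBuildingSet.exists_component (hB : IsBuildingSet B V) (hS : S ∈ B) (hSY : S ⊆ Y) :
    ∃ T, IsComponent B Y T ∧ S ⊆ T := by
  obtain ⟨T, hT, hmax⟩ := Finset.exists_max_image
    (B.filter (fun T => S ⊆ T ∧ T ⊆ Y)) Finset.card ⟨S, by simp [hS, hSY]⟩
  simp only [Finset.mem_filter] at hT hmax
  refine ⟨T, ⟨hT.1, hT.2.2, fun W hW hWY hd => ?_⟩, hT.2.1⟩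
  have h := hmax (W ∪ T) ⟨hB.union hW hT.1 hd, hT.2.1.trans Finset.subset_union_right,
    Finset.union_subset hWY hT.2.2⟩
  have := Finset.eq_of_subset_of_card_le (Finset.subset_union_right : T ⊆ W ∪ T) h
  rw [this]
  exact Finset.subset_union_left

theorem IsBuildingSet.exists_component_of_mem (hB : IsBuildingSet B V) (hY : Y ⊆ V) (hx : x ∈ Y) :
    ∃ T, IsComponent B Y T ∧ x ∈ T := by
  obtain ⟨T, hT, h⟩ := hB.exists_component (hB.singleton (hY hx)) (Finset.singleton_subset_iff.2 hx)
  exact ⟨T, hT, h (Finset.mem_singleton_self x)⟩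

omit [DecidableEq α] in
theorem IsComponent.eq_of_not_disjoint (hS : IsComponent B Y S) (hT : IsComponent B Y T)
    (h : ¬ Disjoint S T) : S = T :=
  (hT.2.2 S hS.1 hS.2.1 h).antisymm (hS.2.2 T hT.1 hT.2.1 (fun h' => h h'.symm))

theorem Nested.mono {M : Finset (Finset α)} (hN : Nested B N) (h : M ⊆ N) : Nested B M :=
  ⟨h.trans hN.1, fun M' hM' => hN.2 M' (hM'.trans h)⟩

theorem SpanningNested.of_subset {M : Finset (Finset α)} (hN : SpanningNested B V N)
    (h : N ⊆ M) (hM : Nested B M) : SpanningNested B V M :=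
  ⟨hM, fun T hT => h (hN.2 T hT)⟩

theorem Nested.comparable (hB : IsBuildingSet B V) (hN : Nested B N) (hS : S ∈ N) (hT : T ∈ N)
    (h : ¬ Disjoint S T) : S ⊆ T ∨ T ⊆ S := by
  have := hN.2 {S, T} (by simp [Finset.insert_subset_iff, hS, hT])
    (by simpa using hB.union (hN.1 hS) (hN.1 hT) h)
  simp only [Finset.sup_insert, id, Finset.sup_singleton, Finset.mem_insert, Finset.mem_singleton,
    Finset.sup_eq_union, Finset.union_eq_left, Finset.union_eq_right] at this
  exact this.symm

/-- With an empty label, `S` would be the union of strictly smaller members of `N`, which nestedness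
forbids. -/
theorem Nested.label_nonempty (hN : Nested B N) (hS : S ∈ N) : (label N S).Nonempty := by
  by_contra hcon
  rw [Finset.not_nonempty_iff_eq_empty] at hcon
  have hsup : (N.filter (· ⊂ S)).sup id = S := by
    apply le_antisymm
    · exact Finset.sup_le fun U hU => (Finset.mem_filter.1 hU).2.1
    · intro x hx
      have : x ∉ label N S := by simp [hcon]
      rw [mem_label] at this
      push Not at this
      obtain ⟨U, hU, hUS, hxU⟩ := this hx
      exact Finset.mem_sup.2 ⟨U, by simp [hU, hUS], hxU⟩
  have := hN.2 (N.filter (· ⊂ S)) (Finset.filter_subset _ _) (by rw [hsup]; exact hN.1 hS)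
  rw [hsup] at this
  exact (Finset.mem_filter.1 this).2.2 subset_rfl

theorem SpanningNested.exists_mem_label (hB : IsBuildingSet B V) (hN : SpanningNested B V N)
    (hx : x ∈ V) : ∃ S ∈ N, x ∈ label N S := by
  obtain ⟨T, hT, hxT⟩ := hB.exists_component_of_mem subset_rfl hx
  obtain ⟨S, hS, hmin⟩ := Finset.exists_min_image (N.filter (x ∈ ·)) Finset.card
    ⟨T, by simp [hN.2 T hT, hxT]⟩
  simp only [Finset.mem_filter] at hS hmin
  refine ⟨S, hS.1, mem_label.2 ⟨hS.2, fun U hU hUS hxU => ?_⟩⟩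
  exact absurd (Finset.card_lt_card hUS) (not_lt.2 (hmin U ⟨hU, hxU⟩))

theorem Nested.subset_of_mem_label (hB : IsBuildingSet B V) (hN : Nested B N) (hS : S ∈ N)
    (hx : x ∈ label N S) (hU : U ∈ N) (hxU : x ∈ U) : S ⊆ U := by
  rw [mem_label] at hx
  rcases hN.comparable hB hS hU (not_disjoint_of_mem hx.1 hxU) with h | h
  · exact h
  · by_contra hcon
    exact hx.2 U hU ⟨h, hcon⟩ hxU

theorem Nested.eq_of_mem_label (hB : IsBuildingSet B V) (hN : Nested B N) (hS : S ∈ N)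
    (hT : T ∈ N) (hxS : x ∈ label N S) (hxT : x ∈ label N T) : S = T :=
  (hN.subset_of_mem_label hB hS hxS hT (mem_label.1 hxT).1).antisymm
    (hN.subset_of_mem_label hB hT hxT hS (mem_label.1 hxS).1)

theorem SpanningNested.sum_card_label (hB : IsBuildingSet B V) (hN : SpanningNested B V N) :
    ∑ S ∈ N, (label N S).card = V.card := by
  rw [← Finset.card_biUnion]
  · congr 1
    ext x
    simp only [Finset.mem_biUnion]
    constructor
    · rintro ⟨S, hS, hx⟩
      exact hB.subset (hN.1.1 hS) (mem_label.1 hx).1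
    · exact fun hx => hN.exists_mem_label hB hx
  · intro S hS T hT hne
    rw [Function.onFun, Finset.disjoint_left]
    exact fun x hxS hxT => hne (hN.1.eq_of_mem_label hB hS hT hxS hxT)

theorem SpanningNested.card_le (hB : IsBuildingSet B V) (hN : SpanningNested B V N) :
    N.card ≤ V.card := by
  rw [← hN.sum_card_label hB, Finset.card_eq_sum_ones]
  exact Finset.sum_le_sum fun S hS => (hN.1.label_nonempty hS).card_pos

/-- Adding a maximal member of `B` below `S \ {x}` to a nested set, for `x` a label of `S`. -/
theorem Nested.insert_component (hB : IsBuildingSet B V) (hN : Nested B N) (hS : S ∈ N)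
    (hx : x ∈ label N S) (hT : IsComponent B (S \ {x}) T) : Nested B (insert T N) := by
  refine ⟨Finset.insert_subset hT.1 hN.1, fun M hM hW => ?_⟩
  have hTS : T ⊆ S := hT.2.1.trans Finset.sdiff_subset
  by_cases hTM : T ∈ M
  swap
  · exact hN.2 M ((Finset.subset_insert_iff_of_notMem hTM).1 hM) hW
  have hTW : T ⊆ M.sup id := Finset.le_sup (f := id) hTM
  obtain ⟨t, ht⟩ := hB.nonempty hT.1
  -- Trading `T` for `S` turns `M` into a subfamily of `N` with union `M.sup id ∪ S`. This lies in
  -- `B` because both parts contain `T`, so nestedness of `N` applies to it.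
  have hsup : (insert S (M.erase T)).sup id = M.sup id ∪ S := by
    have h1 : M.sup id = T ∪ (M.erase T).sup id := by
      conv_lhs => rw [← Finset.insert_erase hTM]
      simp
    rw [h1, Finset.sup_insert]
    ext z
    simp only [id, Finset.sup_eq_union, Finset.mem_union]
    have := @hTS z
    tauto
  have hmem := hN.2 (insert S (M.erase T))
    (Finset.insert_subset hS (Finset.subset_insert_iff.1 hM))
    (by rw [hsup]; exact hB.union hW (hN.1 hS) (not_disjoint_of_mem (hTW ht) (hTS ht)))
  rw [hsup, Finset.mem_insert] at hmem
  rcases hmem with hmem | hmem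
  · by_cases hSM : S ∈ M
    · have : S ⊆ M.sup id := Finset.le_sup (f := id) hSM
      rw [Finset.union_eq_right] at hmem
      rwa [hmem.antisymm this]
    · rw [Finset.union_eq_right] at hmem
      -- `T` avoids `x`, and so does every member of `N` strictly inside `S`, as `x` is a label. The
      -- union thus lies below `S \ {x}` and is absorbed by the component `T`.
      have hWx : M.sup id ⊆ S \ {x} := by
        refine Finset.sup_le fun U hU => ?_
        have hUS : U ⊆ S := (Finset.le_sup (f := id) hU).trans hmem
        rcases Finset.mem_insert.1 (hM hU) with rfl | hUN
        · exact hT.2.1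
        · have : U ⊂ S := hUS.ssubset_of_ne (fun h => hSM (h ▸ hU))
          rw [id, Finset.subset_sdiff, Finset.disjoint_singleton_right]
          exact ⟨hUS, (mem_label.1 hx).2 U hUN this⟩
      have := hT.2.2 _ hW hWx (not_disjoint_of_mem (hTW ht) ht)
      rwa [this.antisymm hTW]
  · have hmem := Finset.mem_of_mem_erase hmem
    have h1 : M.sup id ∪ S ⊆ M.sup id := Finset.le_sup (f := id) hmem
    rwa [h1.antisymm Finset.subset_union_left] at hmem

/-- A member of `B` which may be added to the nested set `N` separates two labels of the
smallest member of `N` above it. -/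
theorem SpanningNested.exists_separated_labels (hB : IsBuildingSet B V)
    (hN : SpanningNested B V N) (hT : T ∉ N) (hTN : Nested B (insert T N)) :
    ∃ S ∈ N, T ⊂ S ∧ (∃ y ∈ label N S, y ∈ T) ∧ ∃ x ∈ label N S, x ∉ T := by
  -- After adding `T`, both `T` and the member `S` of `N` that owns `y` still have labels: `y` is
  -- one inside `T`, and a label of `S` must avoid `T`.
  obtain ⟨y, hy⟩ := hTN.label_nonempty (Finset.mem_insert_self T N)
  have hyT := (mem_label.1 hy).1
  obtain ⟨S, hS, hyS⟩ := hN.exists_mem_label hB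
    (hB.subset (hTN.1 (Finset.mem_insert_self T N)) hyT)
  have hTS : T ⊆ S := hTN.subset_of_mem_label hB (Finset.mem_insert_self T N) hy
    (Finset.mem_insert_of_mem hS) (mem_label.1 hyS).1
  have hTS' : T ⊂ S := hTS.ssubset_of_ne (fun h => hT (h ▸ hS))
  obtain ⟨x, hx⟩ := hTN.label_nonempty (Finset.mem_insert_of_mem hS)
  rw [mem_label] at hx
  refine ⟨S, hS, hTS', ⟨y, hyS, hyT⟩, x, mem_label.2 ⟨hx.1, fun U hU => ?_⟩, ?_⟩
  · exact hx.2 U (Finset.mem_insert_of_mem hU)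
  · exact hx.2 T (Finset.mem_insert_self T N) hTS'

theorem notMem_of_mem_label_of_ssubset (hy : y ∈ label N S) (hyT : y ∈ T) (hTS : T ⊂ S) : T ∉ N :=
  fun h => (mem_label.1 hy).2 T h hTS hyT

theorem IsComponent.ssubset (hT : IsComponent B (S \ {x}) T) (hx : x ∈ S) : T ⊂ S := by
  refine ⟨hT.2.1.trans Finset.sdiff_subset, fun h => ?_⟩
  simpa using hT.2.1 (h hx)

theorem IsComponent.notMem (hT : IsComponent B (S \ {x}) T) : x ∉ T := fun h => by
  simpa using hT.2.1 h

theorem IsBuildingSet.exists_component_diff (hB : IsBuildingSet B V) (hS : S ∈ B) (hy : y ∈ S)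
    (hxy : y ≠ x) : ∃ T, IsComponent B (S \ {x}) T ∧ y ∈ T :=
  hB.exists_component_of_mem (Finset.sdiff_subset.trans (hB.subset hS)) (by simp [hy, hxy])

/-- A nested set with fewer members than elements of the ground set can be enlarged. -/
theorem SpanningNested.exists_insert (hB : IsBuildingSet B V) (hN : SpanningNested B V N)
    (h : N.card < V.card) : ∃ T, T ∉ N ∧ Nested B (insert T N) := by
  rw [← hN.sum_card_label hB, Finset.card_eq_sum_ones] at h
  -- By pigeonhole some label has two elements `x`, `y`. The component of `S \ {x}` through `y` is
  -- new, because `y` lies in no member of `N` strictly inside `S`.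
  obtain ⟨S, hS, hlt⟩ := Finset.exists_lt_of_sum_lt h
  obtain ⟨x, hx, y, hy, hne⟩ := Finset.one_lt_card.1 hlt
  obtain ⟨T, hT, hyT⟩ := hB.exists_component_diff (hN.1.1 hS) (mem_label.1 hy).1 hne.symm
  exact ⟨T, notMem_of_mem_label_of_ssubset hy hyT (hT.ssubset (mem_label.1 hx).1),
    hN.1.insert_component hB hS hx hT⟩

theorem SpanningNested.exists_maximal (hB : IsBuildingSet B V) (hN : SpanningNested B V N) :
    ∃ K, N ⊆ K ∧ SpanningNested B V K ∧ K.card = V.card := by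
  induction h : V.card - N.card generalizing N with
  | zero => exact ⟨N, subset_rfl, hN, le_antisymm (hN.card_le hB) (by omega)⟩
  | succ k ih =>
    obtain ⟨T, hT, hTN⟩ := hN.exists_insert hB (by omega)
    obtain ⟨K, hK, h1, h2⟩ := ih (hN.of_subset (Finset.subset_insert T N) hTN)
      (by rw [Finset.card_insert_of_notMem hT]; omega)
    exact ⟨K, (Finset.subset_insert T N).trans hK, h1, h2⟩

/-- A nested set which lacks one member can be completed in exactly two ways. -/
theorem SpanningNested.exists_two_completions (hB : IsBuildingSet B V)
    (hN : SpanningNested B V N) (h : N.card + 1 = V.card) :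
    ∃ T₁ T₂, T₁ ≠ T₂ ∧ ∀ T, (T ∉ N ∧ Nested B (insert T N)) ↔ T = T₁ ∨ T = T₂ := by
  have hsum := hN.sum_card_label hB
  have hlt : N.card < V.card := by omega
  rw [← hsum, Finset.card_eq_sum_ones] at hlt
  obtain ⟨S, hS, hlt⟩ := Finset.exists_lt_of_sum_lt hlt
  have hpos : ∀ R ∈ N, 1 ≤ (label N R).card := fun R hR => (hN.1.label_nonempty hR).card_pos
  have herase : (N.erase S).card ≤ ∑ R ∈ N.erase S, (label N R).card := by
    rw [Finset.card_eq_sum_ones]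
    exact Finset.sum_le_sum fun R hR => hpos R (Finset.mem_of_mem_erase hR)
  have hadd := Finset.add_sum_erase N (fun R => (label N R).card) hS
  have hcard := Finset.card_erase_add_one hS
  -- The nonempty labels have total size `|N| + 1`, so one has two elements and all others have one.
  have h2 : (label N S).card = 2 := by omega
  have hone : ∀ R ∈ N, R ≠ S → (label N R).card = 1 := by
    intro R hR hRS
    have hadd' := Finset.add_sum_erase (N.erase S) (fun R => (label N R).card)
      (Finset.mem_erase.2 ⟨hRS, hR⟩)
    have hcard' := Finset.card_erase_add_one (Finset.mem_erase.2 ⟨hRS, hR⟩)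
    have : ((N.erase S).erase R).card ≤ ∑ R ∈ (N.erase S).erase R, (label N R).card := by
      rw [Finset.card_eq_sum_ones]
      exact Finset.sum_le_sum fun R hR =>
        hpos R (Finset.mem_of_mem_erase (Finset.mem_of_mem_erase hR))
    have := hpos R hR
    omega
  obtain ⟨x, y, hxy, hL⟩ := Finset.card_eq_two.1 h2
  have hx : x ∈ label N S := by simp [hL]
  have hy : y ∈ label N S := by simp [hL]
  have hxS := (mem_label.1 hx).1
  have hyS := (mem_label.1 hy).1
  obtain ⟨Ty, hTy, hyTy⟩ := hB.exists_component_diff (x := x) (hN.1.1 hS) hyS hxy.symm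
  obtain ⟨Tx, hTx, hxTx⟩ := hB.exists_component_diff (x := y) (hN.1.1 hS) hxS hxy
  -- An addition that separates the two labels is forced to be a component: `T` and the members of
  -- `N` below `Ty` together cover `Ty`, so nestedness puts `Ty` among them, and `Ty ∉ N`.
  have key : ∀ {x y T Ty}, label N S = {x, y} → IsComponent B (S \ {x}) Ty → y ∈ Ty →
      Nested B (insert T N) → T ⊂ S → y ∈ T → x ∉ T → T = Ty := by
    intro x y T Ty hL hTy hyTy hTN hTS hyT hxT
    have hx : x ∈ label N S := by simp [hL]
    have hy : y ∈ label N S := by simp [hL]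
    have hTsub : T ⊆ Ty := hTy.2.2 T (hTN.1 (Finset.mem_insert_self T N))
      (Finset.subset_sdiff.2 ⟨hTS.1, Finset.disjoint_singleton_right.2 hxT⟩)
      (not_disjoint_of_mem hyT hyTy)
    have hsup : (insert T (N.filter (· ⊆ Ty))).sup id = Ty := by
      apply le_antisymm
      · refine Finset.sup_le fun U hU => ?_
        rcases Finset.mem_insert.1 hU with rfl | hU
        · exact hTsub
        · exact (Finset.mem_filter.1 hU).2
      · intro z hz
        by_cases hzy : z = y
        · exact Finset.mem_sup.2 ⟨T, Finset.mem_insert_self _ _, hzy ▸ hyT⟩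
        have hzx : z ≠ x := fun h => hTy.notMem (h ▸ hz)
        have : z ∉ label N S := by simp [hL, hzy, hzx]
        rw [mem_label] at this
        push Not at this
        obtain ⟨U, hU, hUS, hzU⟩ := this ((hTy.ssubset (mem_label.1 hx).1).1 hz)
        have hUT : U ⊆ Ty := hTy.2.2 U (hN.1.1 hU)
          (Finset.subset_sdiff.2 ⟨hUS.1, Finset.disjoint_singleton_right.2
            ((mem_label.1 hx).2 U hU hUS)⟩) (not_disjoint_of_mem hzU hz)
        exact Finset.mem_sup.2 ⟨U, by simp [hU, hUT], hzU⟩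
    have := hTN.2 (insert T (N.filter (· ⊆ Ty)))
      (Finset.insert_subset_insert _ (Finset.filter_subset _ _)) (by rw [hsup]; exact hTy.1)
    rw [hsup, Finset.mem_insert] at this
    rcases this with h | h
    · exact h.symm
    · exact absurd (Finset.mem_filter.1 h).1
        (notMem_of_mem_label_of_ssubset hy hyTy (hTy.ssubset (mem_label.1 hx).1))
  refine ⟨Tx, Ty, fun h => hTy.notMem (h ▸ hxTx), fun T => ⟨fun ⟨hT, hTN⟩ => ?_, ?_⟩⟩
  · obtain ⟨R, hR, hTR, ⟨a, ha, haT⟩, b, hb, hbT⟩ := hN.exists_separated_labels hB hT hTN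
    have hRS : R = S := by
      by_contra hRS
      obtain ⟨c, hc⟩ := Finset.card_eq_one.1 (hone R hR hRS)
      simp only [hc, Finset.mem_singleton] at ha hb
      exact hbT (hb ▸ ha ▸ haT)
    subst hRS
    have ha' := ha
    have hb' := hb
    rw [hL, Finset.mem_insert, Finset.mem_singleton] at ha' hb'
    rcases ha' with rfl | rfl <;> rcases hb' with rfl | rfl
    · exact absurd haT hbT
    · exact .inl (key (by rw [hL, Finset.pair_comm]) hTx hxTx hTN hTR haT hbT)
    · exact .inr (key hL hTy hyTy hTN hTR haT hbT)
    · exact absurd haT hbT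
  · rintro (rfl | rfl)
    · exact ⟨notMem_of_mem_label_of_ssubset hx hxTx (hTx.ssubset hyS),
        hN.1.insert_component hB hS hy hTx⟩
    · exact ⟨notMem_of_mem_label_of_ssubset hy hyTy (hTy.ssubset hxS),
        hN.1.insert_component hB hS hx hTy⟩

/-- Adjacency of vertices in the link of `N` in the complex of nested sets. -/
def LinkAdj (B N : Finset (Finset α)) (S T : Finset α) : Prop :=
  (S ∉ N ∧ T ∉ N) ∧ Nested B (insert S (insert T N))

theorem LinkAdj.symm (h : LinkAdj B N S T) : LinkAdj B N T S :=
  ⟨h.1.symm, by rw [Finset.insert_comm]; exact h.2⟩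

/-- The point `x` remains a label of `S` after `T` is added, so `U` can be added too. `T = U` is
allowed, since `LinkAdj` does not ask for distinct vertices. -/
theorem linkAdj_of_mem_label (hB : IsBuildingSet B V) (hT : T ∉ N) (hTN : Nested B (insert T N))
    (hS : S ∈ N) (hx : x ∈ label N S) (hxT : T ⊂ S → x ∉ T) (hU : IsComponent B (S \ {x}) U)
    (hUN : U ∉ N) : LinkAdj B N T U := by
  refine LinkAdj.symm ⟨⟨hUN, hT⟩, hTN.insert_component hB (Finset.mem_insert_of_mem hS) ?_ hU⟩
  refine mem_label.2 ⟨(mem_label.1 hx).1, fun R hR hRS => ?_⟩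
  rcases Finset.mem_insert.1 hR with rfl | hR
  · exact hxT hRS
  · exact (mem_label.1 hx).2 R hR hRS

/-- Links of codimension at least two in the complex of nested sets are connected. -/
theorem SpanningNested.link_connected (hB : IsBuildingSet B V) (hN : SpanningNested B V N)
    (h : N.card + 2 ≤ V.card) {T₁ T₂ : Finset α} (hT₁ : T₁ ∉ N) (hT₁N : Nested B (insert T₁ N))
    (hT₂ : T₂ ∉ N) (hT₂N : Nested B (insert T₂ N)) :
    Relation.ReflTransGen (LinkAdj B N) T₁ T₂ := by
  have hnew : ∀ {S x y U}, x ∈ label N S → y ∈ label N S → IsComponent B (S \ {x}) U → y ∈ U →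
      U ∉ N := fun hx hy hU hyU =>
    notMem_of_mem_label_of_ssubset hy hyU (hU.ssubset (mem_label.1 hx).1)
  -- every vertex is adjacent to a component
  have canon : ∀ {T}, T ∉ N → Nested B (insert T N) → ∃ S ∈ N, ∃ x ∈ label N S,
      ∃ y ∈ label N S, ∃ U, IsComponent B (S \ {x}) U ∧ y ∈ U ∧ LinkAdj B N T U := by
    intro T hT hTN
    obtain ⟨S, hS, hTS, ⟨y, hy, hyT⟩, x, hx, hxT⟩ := hN.exists_separated_labels hB hT hTN
    obtain ⟨U, hU, hyU⟩ := hB.exists_component_diff (x := x) (hN.1.1 hS) (mem_label.1 hy).1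
      (fun h => hxT (h ▸ hyT))
    exact ⟨S, hS, x, hx, y, hy, U, hU, hyU,
      linkAdj_of_mem_label hB hT hTN hS hx (fun _ => hxT) hU (hnew hx hy hU hyU)⟩
  -- components of different members of `N`
  have diff : ∀ {S x y U S' x' y' U'}, S ∈ N → x ∈ label N S → y ∈ label N S →
      IsComponent B (S \ {x}) U → y ∈ U → S' ∈ N → x' ∈ label N S' → y' ∈ label N S' →
      IsComponent B (S' \ {x'}) U' → y' ∈ U' → S ≠ S' → LinkAdj B N U U' := by
    intro S x y U S' x' y' U' hS hx hy hU hyU hS' hx' hy' hU' hyU' hne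
    refine linkAdj_of_mem_label hB (hnew hx hy hU hyU) (hN.1.insert_component hB hS hx hU) hS' hx'
      -- If `U ⊂ S'` contained `x'`, then `x' ∈ S` would give `S' ⊂ S`, and `y ∈ U ⊂ S'` could not
      -- be a label of `S`.
      (fun hUS' hxU => ?_) hU' (hnew hx' hy' hU' hyU')
    have hsub : S' ⊆ S := hN.1.subset_of_mem_label hB hS' hx' hS
      ((hU.ssubset (mem_label.1 hx).1).1 hxU)
    exact (mem_label.1 hy).2 S' hS' (hsub.ssubset_of_ne hne.symm) (hUS'.1 hyU)
  -- components for the same label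
  have same : ∀ {S x y U y' U'}, S ∈ N → x ∈ label N S → y ∈ label N S →
      IsComponent B (S \ {x}) U → y ∈ U → y' ∈ label N S →
      IsComponent B (S \ {x}) U' → y' ∈ U' → LinkAdj B N U U' := by
    intro S x y U y' U' hS hx hy hU hyU hy' hU' hyU'
    exact linkAdj_of_mem_label hB (hnew hx hy hU hyU) (hN.1.insert_component hB hS hx hU) hS hx
      (fun _ => hU.notMem) hU' (hnew hx hy' hU' hyU')
  obtain ⟨S, hS, x, hx, y, hy, U, hU, hyU, hadj⟩ := canon hT₁ hT₁N
  obtain ⟨S', hS', x', hx', y', hy', U', hU', hyU', hadj'⟩ := canon hT₂ hT₂N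
  suffices Relation.ReflTransGen (LinkAdj B N) U U' from
    (Relation.ReflTransGen.head hadj this).tail hadj'.symm
  by_cases hSS : S = S'
  swap
  · exact .single (diff hS hx hy hU hyU hS' hx' hy' hU' hyU' hSS)
  subst hSS
  by_cases hxx : x = x'
  · subst hxx
    exact .single (same hS hx hy hU hyU hy' hU' hyU')
  -- Another member with two labels supplies a common neighbour. Otherwise the whole deficit of at
  -- least two sits at `S`, whose label then has a third element `z`.
  by_cases hR : ∃ R ∈ N, R ≠ S ∧ 1 < (label N R).card
  · obtain ⟨R, hR, hRS, hlt⟩ := hR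
    obtain ⟨a, ha, b, hb, hne⟩ := Finset.one_lt_card.1 hlt
    obtain ⟨W, hW, hbW⟩ := hB.exists_component_diff (x := a) (hN.1.1 hR) (mem_label.1 hb).1 hne.symm
    exact .tail (.single (diff hS hx hy hU hyU hR ha hb hW hbW hRS.symm))
      (diff hR ha hb hW hbW hS hx' hy' hU' hyU' hRS)
  · push Not at hR
    have hsum := hN.sum_card_label hB
    have hadd := Finset.add_sum_erase N (fun R => (label N R).card) hS
    have hcard := Finset.card_erase_add_one hS
    have hle : ∑ R ∈ N.erase S, (label N R).card ≤ (N.erase S).card := by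
      rw [Finset.card_eq_sum_ones]
      exact Finset.sum_le_sum fun R hR' =>
        hR R (Finset.mem_of_mem_erase hR') (Finset.ne_of_mem_erase hR')
    have h3 : ({x, x'} : Finset α).card < (label N S).card := by
      rw [Finset.card_pair hxx]
      omega
    obtain ⟨z, hz, hzx⟩ := Finset.exists_mem_notMem_of_card_lt_card h3
    simp only [Finset.mem_insert, Finset.mem_singleton, not_or] at hzx
    obtain ⟨T, hT, hzT⟩ := hB.exists_component_diff (x := x) (hN.1.1 hS) (mem_label.1 hz).1 hzx.1
    obtain ⟨T', hT', hzT'⟩ := hB.exists_component_diff (x := x') (hN.1.1 hS) (mem_label.1 hz).1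
      hzx.2
    have hTnew := hnew hx hz hT hzT
    have hTN := hN.1.insert_component hB hS hx hT
    have hTS := hT.ssubset (mem_label.1 hx).1
    suffices Relation.ReflTransGen (LinkAdj B N) T T' from
      (Relation.ReflTransGen.head (same hS hx hy hU hyU hz hT hzT) this).tail
        (same hS hx' hz hT' hzT' hy' hU' hyU')
    by_cases hxT : x' ∈ T
    swap
    · exact .single (linkAdj_of_mem_label hB hTnew hTN hS hx' (fun _ => hxT) hT'
        (hnew hx' hz hT' hzT'))
    obtain ⟨W, hW, hzW⟩ := hB.exists_component_diff (x := x') hT.1 hzT hzx.2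
    have hWT := hW.ssubset hxT
    have hxlab : x' ∈ label (insert T N) T := by
      refine mem_label.2 ⟨hxT, fun R hR hRT => ?_⟩
      rcases Finset.mem_insert.1 hR with rfl | hR
      · exact absurd subset_rfl hRT.2
      · exact (mem_label.1 hx').2 R hR (hRT.trans hTS)
    have hWTN := hTN.insert_component hB (Finset.mem_insert_self T N) hxlab hW
    have hWnew : W ∉ N := notMem_of_mem_label_of_ssubset hz hzW (hWT.trans hTS)
    have hWN : Nested B (insert W N) :=
      hWTN.mono (Finset.insert_subset_insert _ (Finset.subset_insert _ _))
    exact .tail (.single (LinkAdj.symm ⟨⟨hWnew, hTnew⟩, hWTN⟩))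
      (linkAdj_of_mem_label hB hWnew hWN hS hx' (fun _ => hW.notMem) hT' (hnew hx' hz hT' hzT'))

end BuildingSets

/-! ### Tubes of a hypergraph, connectedness, and constructs as nested sets of tubes. -/

section Tubes

variable {α : Type u} [DecidableEq α] {H J K N : Finset (Finset α)} {S T U X Y C : Finset α} {x : α}

theorem mem_carrier : x ∈ carrier H ↔ ∃ X ∈ H, x ∈ X := by
  simp [carrier]

theorem mem_restrict : X ∈ restrict H Y ↔ X ∈ H ∧ X ⊆ Y := by
  simp [restrict]

theorem subset_carrier (hX : X ∈ H) : X ⊆ carrier H := Finset.le_sup (f := id) hX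

theorem carrier_mono (h : H ⊆ J) : carrier H ⊆ carrier J := Finset.sup_mono h

omit [DecidableEq α] in
theorem IsHypergraph.nonempty (hH : IsHypergraph H) (hX : X ∈ H) : X.Nonempty :=
  Finset.nonempty_iff_ne_empty.2 fun h => hH (h ▸ hX)

omit [DecidableEq α] in
theorem IsHypergraph.mono (hH : IsHypergraph H) (h : J ⊆ H) : IsHypergraph J :=
  fun h' => hH (h h')

theorem carrier_restrict (hA : IsAtomic H) (hY : Y ⊆ carrier H) : carrier (restrict H Y) = Y := by
  ext x
  rw [mem_carrier]
  constructor
  · rintro ⟨X, hX, hx⟩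
    exact (mem_restrict.1 hX).2 hx
  · exact fun hx => ⟨{x}, mem_restrict.2 ⟨hA x (hY hx), Finset.singleton_subset_iff.2 hx⟩,
      Finset.mem_singleton_self x⟩

theorem restrict_subset : restrict H Y ⊆ H := Finset.filter_subset _ _

theorem IsAtomic.restrict (hA : IsAtomic H) (Y : Finset α) : IsAtomic (restrict H Y) := by
  intro x hx
  obtain ⟨X, hX, hxX⟩ := mem_carrier.1 hx
  rw [mem_restrict] at hX ⊢
  exact ⟨hA x (mem_carrier.2 ⟨X, hX.1, hxX⟩), Finset.singleton_subset_iff.2 (hX.2 hxX)⟩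

/-- The nonempty subsets `Y` of the carrier of `H` which cannot be separated by a set `A` without
separating a member of `H` below `Y`. -/
def IsTube (H : Finset (Finset α)) (Y : Finset α) : Prop :=
  Y.Nonempty ∧ Y ⊆ carrier H ∧
    ∀ A, (∀ X ∈ H, X ⊆ Y → X ⊆ A ∨ Disjoint X A) → Y ⊆ A ∨ Disjoint Y A

open Classical in
/-- The building set of all tubes of `H`. -/
noncomputable def tubes (H : Finset (Finset α)) : Finset (Finset α) :=
  (carrier H).powerset.filter (IsTube H)

theorem mem_tubes : Y ∈ tubes H ↔ IsTube H Y := by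
  simp only [tubes, Finset.mem_filter, Finset.mem_powerset, and_iff_right_iff_imp]
  exact fun h => h.2.1

theorem isBuildingSet_tubes (H : Finset (Finset α)) : IsBuildingSet (tubes H) (carrier H) where
  nonempty hS := (mem_tubes.1 hS).1
  subset hS := (mem_tubes.1 hS).2.1
  singleton hx := mem_tubes.2 ⟨Finset.singleton_nonempty _, Finset.singleton_subset_iff.2 hx,
    fun A _ => by
      rw [Finset.singleton_subset_iff, Finset.disjoint_singleton_left]
      exact em _⟩
  union {S T} hS hT hd := by
    rw [mem_tubes] at hS hT ⊢
    refine ⟨hS.1.mono Finset.subset_union_left, Finset.union_subset hS.2.1 hT.2.1, fun A hA => ?_⟩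
    obtain ⟨z, hzS, hzT⟩ := Finset.not_disjoint_iff.1 hd
    have h1 := hS.2.2 A fun X hX h => hA X hX (h.trans Finset.subset_union_left)
    have h2 := hT.2.2 A fun X hX h => hA X hX (h.trans Finset.subset_union_right)
    rcases h1 with h1 | h1 <;> rcases h2 with h2 | h2
    · exact .inl (Finset.union_subset h1 h2)
    · exact absurd (h1 hzS) (Finset.disjoint_left.1 h2 hzT)
    · exact absurd (h2 hzT) (Finset.disjoint_left.1 h1 hzS)
    · exact .inr (Finset.disjoint_union_left.2 ⟨h1, h2⟩)

theorem IsHypergraph.isTube (hH : IsHypergraph H) (hX : X ∈ H) : IsTube H X :=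
  ⟨hH.nonempty hX, subset_carrier hX, fun _ hA => hA X hX subset_rfl⟩

theorem IsTube.mono (h : H ⊆ J) (hY : IsTube H Y) : IsTube J Y :=
  ⟨hY.1, hY.2.1.trans (carrier_mono h), fun A hA => hY.2.2 A fun X hX => hA X (h hX)⟩

theorem isTube_restrict (hA : IsAtomic H) (hY : Y ⊆ carrier H) :
    IsTube (restrict H Y) S ↔ IsTube H S ∧ S ⊆ Y := by
  constructor
  · intro h
    have h2 := h.2.1
    rw [carrier_restrict hA hY] at h2
    exact ⟨h.mono restrict_subset, h2⟩
  · rintro ⟨h, hS⟩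
    refine ⟨h.1, by rwa [carrier_restrict hA hY], fun A hA => h.2.2 A fun X hX hXS => ?_⟩
    exact hA X (mem_restrict.2 ⟨hX, hXS.trans hS⟩) hXS

theorem isComponent_restrict (hA : IsAtomic H) (hY : Y ⊆ carrier H) :
    IsComponent (tubes (restrict H Y)) Y T ↔ IsComponent (tubes H) Y T := by
  simp only [IsComponent, mem_tubes, isTube_restrict hA hY]
  constructor
  · exact fun h => ⟨h.1.1, h.2.1, fun W hW hWY => h.2.2 W ⟨hW, hWY⟩ hWY⟩
  · exact fun h => ⟨⟨h.1, h.2.1⟩, h.2.1, fun W hW => h.2.2 W hW.1⟩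

/-! ### Hypergraph partitions -/

/-- Atomicity makes the carrier of `restrict H C` the whole block `C`, so a partition of the carrier
that splits no member of `H` lifts to `H`. -/
theorem exists_isHypergraphPartition (hH : IsHypergraph H) (hA : IsAtomic H)
    (𝒞 : Finset (Finset α)) (hne : ∀ C ∈ 𝒞, C.Nonempty)
    (hdisj : ∀ C ∈ 𝒞, ∀ D ∈ 𝒞, C ≠ D → Disjoint C D) (hsup : 𝒞.sup id = carrier H)
    (hcov : ∀ X ∈ H, ∃ C ∈ 𝒞, X ⊆ C) :
    ∃ P : Finpartition H, P.parts = 𝒞.image (restrict H) ∧ IsHypergraphPartition P := by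
  have hsub : ∀ C ∈ 𝒞, C ⊆ carrier H := fun C hC => by
    rw [← hsup]
    exact Finset.le_sup (f := id) hC
  have hcar : ∀ C ∈ 𝒞, carrier (restrict H C) = C := fun C hC => carrier_restrict hA (hsub C hC)
  refine ⟨⟨𝒞.image (restrict H), ?_, ?_, ?_⟩, rfl, ?_, ?_, ?_⟩
  · rw [Finset.supIndep_iff_pairwiseDisjoint]
    intro J hJ J' hJ' hne'
    simp only [Finset.coe_image, Set.mem_image, Finset.mem_coe] at hJ hJ'
    obtain ⟨C, hC, rfl⟩ := hJ
    obtain ⟨D, hD, rfl⟩ := hJ'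
    have hd := hdisj C hC D hD (fun h => hne' (h ▸ rfl))
    rw [Function.onFun, id, id, Finset.disjoint_left]
    intro X hX hX'
    rw [mem_restrict] at hX hX'
    obtain ⟨z, hz⟩ := hH.nonempty hX.1
    exact Finset.disjoint_left.1 hd (hX.2 hz) (hX'.2 hz)
  · ext X
    simp only [Finset.mem_sup, Finset.mem_image, exists_exists_and_eq_and, id, mem_restrict]
    constructor
    · rintro ⟨C, -, hX, -⟩
      exact hX
    · intro hX
      obtain ⟨C, hC, hXC⟩ := hcov X hX
      exact ⟨C, hC, hX, hXC⟩
  · rw [Finset.mem_image]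
    rintro ⟨C, hC, h⟩
    have := hcar C hC
    rw [h] at this
    obtain ⟨z, hz⟩ := hne C hC
    rw [← this] at hz
    simp [carrier] at hz
  · intro J hJ
    obtain ⟨C, hC, rfl⟩ := Finset.mem_image.1 hJ
    rw [hcar C hC]
    exact hne C hC
  · intro J hJ J' hJ' hne'
    obtain ⟨C, hC, rfl⟩ := Finset.mem_image.1 hJ
    obtain ⟨D, hD, rfl⟩ := Finset.mem_image.1 hJ'
    rw [hcar C hC, hcar D hD]
    exact hdisj C hC D hD (fun h => hne' (h ▸ rfl))
  · rw [← hsup, Finset.sup_image]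
    exact Finset.sup_congr rfl fun C hC => hcar C hC

theorem IsHypergraphPartition.exists_mem {P : Finpartition H} (hX : X ∈ H) :
    ∃ J ∈ P.parts, X ∈ J := by
  rw [← P.sup_parts] at hX
  simpa using hX

theorem part_subset {P : Finpartition H} (hJ : J ∈ P.parts) : J ⊆ H := P.le hJ

/-- The carrier of a part splits no member of `H`, so it serves as the separating set in `IsTube`.
-/
theorem IsHypergraphPartition.subset_or_disjoint {P : Finpartition H}
    (hP : IsHypergraphPartition P) (hJ : J ∈ P.parts) (hT : IsTube H T) :
    T ⊆ carrier J ∨ Disjoint T (carrier J) := by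
  refine hT.2.2 _ fun X hX _ => ?_
  obtain ⟨J', hJ', hXJ'⟩ := IsHypergraphPartition.exists_mem (P := P) hX
  by_cases h : J' = J
  · subst h
    exact .inl (subset_carrier hXJ')
  · exact .inr ((hP.carrier_disjoint J' hJ' J hJ h).mono_left (subset_carrier hXJ'))

theorem IsHypergraphPartition.eq_restrict {P : Finpartition H} (hH : IsHypergraph H)
    (hP : IsHypergraphPartition P) (hJ : J ∈ P.parts) : J = restrict H (carrier J) := by
  ext X
  rw [mem_restrict]
  constructor
  · exact fun hX => ⟨part_subset hJ hX, subset_carrier hX⟩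
  · rintro ⟨hX, hXJ⟩
    obtain ⟨J', hJ', hXJ'⟩ := IsHypergraphPartition.exists_mem (P := P) hX
    by_cases h : J' = J
    · exact h ▸ hXJ'
    · obtain ⟨z, hz⟩ := hH.nonempty hX
      exact absurd (hXJ hz) (Finset.disjoint_left.1 (hP.carrier_disjoint J' hJ' J hJ h)
        (subset_carrier hXJ' hz))

theorem restrict_carrier : restrict H (carrier H) = H :=
  Finset.filter_true_of_mem fun _ hX => subset_carrier hX

/-- The one-block partition always exists; a set `A` that splits the carrier but no member of `H`
yields a second partition. The empty hypergraph must be excluded: it is connected, but tubes are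
nonempty. -/
theorem connected_iff (hH : IsHypergraph H) (hA : IsAtomic H) (hne : (carrier H).Nonempty) :
    Connected H ↔ IsTube H (carrier H) := by
  obtain ⟨P₀, hP₀, hP₀'⟩ := exists_isHypergraphPartition hH hA {carrier H} (by simpa using hne)
    (by simp) (by simp) (fun X hX => ⟨_, by simp, subset_carrier hX⟩)
  rw [Finset.image_singleton, restrict_carrier] at hP₀
  constructor
  · rintro ⟨P, hP, huniq⟩
    refine ⟨hne, subset_rfl, fun A hA' => ?_⟩
    by_contra hcon
    push Not at hcon
    obtain ⟨a, ha, haA⟩ := Finset.not_subset.1 hcon.1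
    obtain ⟨b, hb, hbA⟩ := Finset.not_disjoint_iff.1 hcon.2
    have hd : Disjoint (carrier H ∩ A) (carrier H \ A) := by
      rw [Finset.disjoint_left]
      intro z hz hz'
      exact (Finset.mem_sdiff.1 hz').2 (Finset.mem_inter.1 hz).2
    obtain ⟨P₁, hP₁, hP₁'⟩ := exists_isHypergraphPartition hH hA {carrier H ∩ A, carrier H \ A}
      (by
        intro C hC
        rw [Finset.mem_insert, Finset.mem_singleton] at hC
        rcases hC with rfl | rfl
        · exact ⟨b, by simp [hb, hbA]⟩
        · exact ⟨a, by simp [ha, haA]⟩)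
      (by
        intro C hC D hD hne
        rw [Finset.mem_insert, Finset.mem_singleton] at hC hD
        rcases hC with rfl | rfl <;> rcases hD with rfl | rfl
        · exact absurd rfl hne
        · exact hd
        · exact hd.symm
        · exact absurd rfl hne)
      (by
        ext z
        simp only [Finset.sup_insert, id, Finset.sup_singleton, Finset.sup_eq_union,
          Finset.mem_union, Finset.mem_inter, Finset.mem_sdiff]
        tauto)
      (by
        intro X hX
        rcases hA' X hX (subset_carrier hX) with h | h
        · exact ⟨_, by simp, Finset.subset_inter (subset_carrier hX) h⟩
        · exact ⟨_, by simp, Finset.subset_sdiff.2 ⟨subset_carrier hX, h⟩⟩)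
    have heq : P₀ = P₁ := (huniq _ hP₀').trans (huniq _ hP₁').symm
    have hmem : restrict H (carrier H ∩ A) ∈ P₀.parts := by
      rw [heq, hP₁]
      simp
    rw [hP₀, Finset.mem_singleton] at hmem
    have := carrier_restrict hA (Finset.inter_subset_left : carrier H ∩ A ⊆ carrier H)
    rw [hmem] at this
    rw [this] at ha
    exact haA (Finset.mem_inter.1 ha).2
  · intro hT
    refine ⟨P₀, hP₀', fun P hP => Finpartition.ext ?_⟩
    have hall : ∀ J ∈ P.parts, J = H := by
      intro J hJ
      have hsub := carrier_mono (part_subset hJ)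
      rcases hP.subset_or_disjoint hJ hT with h | h
      · rw [hP.eq_restrict hH hJ, hsub.antisymm h, restrict_carrier]
      · obtain ⟨z, hz⟩ := hP.carrier_nonempty J hJ
        exact absurd hz (Finset.disjoint_left.1 h (hsub hz))
    obtain ⟨z, hz⟩ := hne
    obtain ⟨X, hX, -⟩ := mem_carrier.1 hz
    obtain ⟨J, hJ, -⟩ := IsHypergraphPartition.exists_mem (P := P) hX
    rw [hP₀]
    exact Finset.eq_singleton_iff_unique_mem.2 ⟨hall J hJ ▸ hJ, hall⟩

theorem connected_restrict_iff (hH : IsHypergraph H) (hA : IsAtomic H) (hY : Y ⊆ carrier H)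
    (hne : Y.Nonempty) : Connected (restrict H Y) ↔ IsTube H Y := by
  have hcar := carrier_restrict hA hY
  rw [connected_iff (hH.mono restrict_subset) (hA.restrict Y) (by rwa [hcar]), hcar,
    isTube_restrict hA hY]
  simp

/-- A connected part has a tube as carrier, and this carrier absorbs every tube it meets.
Conversely, the maximal tubes partition the carrier, and each member of `H`, being a tube, lies in
one of them. -/
theorem mem_components (hH : IsHypergraph H) (hA : IsAtomic H) :
    J ∈ components H ↔ ∃ C, IsComponent (tubes H) (carrier H) C ∧ J = restrict H C := by
  classical
  have hB := isBuildingSet_tubes H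
  simp only [components, Finset.mem_filter, Finset.mem_powerset]
  constructor
  · rintro ⟨-, P, ⟨hP, hconn⟩, hJ⟩
    have heq := hP.eq_restrict hH hJ
    have hne := hP.carrier_nonempty J hJ
    have hsub := carrier_mono (part_subset hJ)
    refine ⟨carrier J, ⟨?_, hsub, fun W hW _ hd => ?_⟩, heq⟩
    · have := hconn J hJ
      rw [heq, connected_restrict_iff hH hA hsub hne] at this
      exact mem_tubes.2 this
    · exact (hP.subset_or_disjoint hJ (mem_tubes.1 hW)).resolve_right hd
  · rintro ⟨C, hC, rfl⟩
    refine ⟨restrict_subset, ?_⟩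
    have hmem : ∀ {D}, D ∈ (tubes H).filter (IsComponent (tubes H) (carrier H)) ↔
        IsComponent (tubes H) (carrier H) D := fun {D} => by
      rw [Finset.mem_filter, and_iff_right_iff_imp]
      exact fun h => h.1
    obtain ⟨P, hP, hP'⟩ := exists_isHypergraphPartition hH hA
      ((tubes H).filter (IsComponent (tubes H) (carrier H)))
      (fun D hD => hB.nonempty (hmem.1 hD).1)
      (fun D hD E hE hne => by
        by_contra hd
        exact hne ((hmem.1 hD).eq_of_not_disjoint (hmem.1 hE) hd))
      (by
        apply le_antisymm
        · exact Finset.sup_le fun D hD => (hmem.1 hD).2.1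
        · intro z hz
          obtain ⟨D, hD, hzD⟩ := hB.exists_component_of_mem subset_rfl hz
          exact Finset.mem_sup.2 ⟨D, hmem.2 hD, hzD⟩)
      (fun X hX => by
        obtain ⟨D, hD, hXD⟩ := hB.exists_component (mem_tubes.2 (hH.isTube hX)) (subset_carrier hX)
        exact ⟨D, hmem.2 hD, hXD⟩)
    refine ⟨P, ⟨hP', fun J hJ => ?_⟩, ?_⟩
    · rw [hP, Finset.mem_image] at hJ
      obtain ⟨D, hD, rfl⟩ := hJ
      rw [hmem] at hD
      exact (connected_restrict_iff hH hA hD.2.1 (hB.nonempty hD.1)).2 (mem_tubes.1 hD.1)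
    · rw [hP]
      exact Finset.mem_image_of_mem _ (hmem.2 hC)

/-- A tube outside `H` is dispensable, so one enhancement suffices. This inclusion is what puts the
face with `*` below every construct. -/
theorem tubes_subset_saturatedClosure (hH : IsHypergraph H) (hA : IsAtomic H) :
    tubes H ⊆ saturatedClosure H := by
  intro Y hY
  rw [mem_tubes] at hY
  simp only [saturatedClosure, Finset.mem_filter, Finset.mem_powerset]
  refine ⟨hY.2.1, ?_⟩
  by_cases hYH : Y ∈ H
  · exact ⟨H, .refl H, hYH⟩
  refine ⟨H ∪ {Y}, .rel _ _ ⟨hH, ?_, Y, ⟨hY.2.1, ?_⟩, hYH, rfl⟩, by simp⟩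
  · rw [IsHypergraph, Finset.mem_union, Finset.mem_singleton, not_or]
    exact ⟨hH, hY.1.ne_empty.symm⟩
  · have : restrict H Y \ {Y} = restrict H Y :=
      by
      rw [Finset.sdiff_singleton_eq_erase]
      exact Finset.erase_eq_of_notMem fun h => hYH (mem_restrict.1 h).1
    rw [this]
    exact ⟨⟨hH.mono restrict_subset, carrier_restrict hA hY.2.1⟩,
      (connected_restrict_iff hH hA hY.2.1 hY.1).2 hY⟩

/-! ### Constructions are the maximal nested sets -/

theorem connectednessNumber_eq_card (hH : IsHypergraph H) (hA : IsAtomic H)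
    (hN : ∀ T, T ∈ N ↔ IsComponent (tubes H) (carrier H) T) : connectednessNumber H = N.card := by
  rw [connectednessNumber]
  have : components H = N.image (restrict H) := by
    ext J
    simp only [mem_components hH hA, Finset.mem_image, hN, eq_comm]
  rw [this, Finset.card_image_of_injOn]
  intro C hC D hD h
  rw [← carrier_restrict hA ((hN C).1 hC).2.1, ← carrier_restrict hA ((hN D).1 hD).2.1]
  exact congrArg carrier h

theorem nested_components {B : Finset (Finset α)} {V : Finset α} (hB : IsBuildingSet B V)
    (hN : ∀ T, T ∈ N ↔ IsComponent B V T) : SpanningNested B V N := by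
  refine ⟨⟨fun T hT => ((hN T).1 hT).1, fun M hM hW => ?_⟩, fun T => (hN T).2⟩
  obtain ⟨z, hz⟩ := hB.nonempty hW
  obtain ⟨T, hT, hzT⟩ := Finset.mem_sup.1 hz
  have h1 := ((hN T).1 (hM hT)).2.2 _ hW (hB.subset hW) (not_disjoint_of_mem hz hzT)
  have h2 : T ⊆ M.sup id := Finset.le_sup (f := id) hT
  rwa [h1.antisymm h2]

theorem carrier_mem_of_isTube (hN : SpanningNested (tubes H) (carrier H) N)
    (h : IsTube H (carrier H)) : carrier H ∈ N :=
  hN.2 _ ⟨mem_tubes.2 h, subset_rfl, fun _ _ hW _ => hW⟩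

/-- Induction on the construction. Tubes of a restriction are the tubes of `H` below it, so
nestedness passes from the pieces to `H`, while the cardinalities add up. -/
theorem IsConstruction.spanningNested (hK : IsConstruction H K) (hH : IsHypergraph H)
    (hA : IsAtomic H) :
    SpanningNested (tubes H) (carrier H) K ∧ K.card = (carrier H).card := by
  induction hK with
  | empty =>
    refine ⟨⟨⟨Finset.empty_subset _, fun M hM hW => ?_⟩, fun T hT => ?_⟩, rfl⟩
    · rw [Finset.subset_empty.1 hM, mem_tubes] at hW
      simpa using hW.1
    · have := mem_tubes.1 hT.1
      exact absurd (this.1.mono this.2.1) (by simp [carrier])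
  | @connected H K x hconn hx hK ih =>
    have hsub : carrier H \ {x} ⊆ carrier H := Finset.sdiff_subset
    obtain ⟨hspan, hcard⟩ := ih (hH.mono restrict_subset) (hA.restrict _)
    have hcar := carrier_restrict hA hsub
    rw [hcar] at hspan hcard
    have hmem : ∀ {U}, U ∈ K → IsTube H U ∧ U ⊆ carrier H \ {x} := fun hU =>
      (isTube_restrict hA hsub).1 (mem_tubes.1 (hspan.1.1 hU))
    have htube := (connected_iff hH hA ⟨x, hx⟩).1 hconn
    have hnot : carrier H ∉ K := fun h => by
      have := (hmem h).2 hx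
      simp at this
    have hKsub : K ∪ {carrier H} ⊆ tubes H := by
      refine Finset.union_subset (fun U hU => mem_tubes.2 (hmem hU).1) ?_
      rw [Finset.singleton_subset_iff]
      exact mem_tubes.2 htube
    refine ⟨⟨⟨hKsub, fun M hM hW => ?_⟩, fun T hT => ?_⟩, ?_⟩
    · by_cases hVM : carrier H ∈ M
      · have h1 : carrier H ⊆ M.sup id := Finset.le_sup (f := id) hVM
        rwa [h1.antisymm (mem_tubes.1 hW).2.1] at hVM
      · have hMK : M ⊆ K := fun U hU => by
          have := hM hU
          rw [Finset.mem_union, Finset.mem_singleton] at this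
          exact this.resolve_right fun h => hVM (h ▸ hU)
        refine hspan.1.2 M hMK (mem_tubes.2 ((isTube_restrict hA hsub).2 ⟨mem_tubes.1 hW, ?_⟩))
        exact Finset.sup_le fun U hU => (hmem (hMK hU)).2
    · obtain ⟨z, hz⟩ := (isBuildingSet_tubes H).nonempty hT.1
      have := hT.2.2 _ (mem_tubes.2 htube) subset_rfl (not_disjoint_of_mem (hT.2.1 hz) hz)
      simp [this.antisymm hT.2.1]
    · rw [Finset.card_union_of_disjoint (Finset.disjoint_singleton_right.2 hnot), hcard,
        Finset.card_singleton, Finset.sdiff_singleton_eq_erase, Finset.card_erase_add_one hx]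
  | @disconnected H hcard hconn K hK ih =>
    have hB := isBuildingSet_tubes H
    have hcomp : ∀ {J}, J ∈ components H → IsComponent (tubes H) (carrier H) (carrier J) ∧
        J = restrict H (carrier J) := by
      intro J hJ
      obtain ⟨C, hC, rfl⟩ := (mem_components hH hA).1 hJ
      rw [carrier_restrict hA hC.2.1]
      exact ⟨hC, rfl⟩
    have hspan : ∀ {J}, J ∈ components H → SpanningNested (tubes J) (carrier J) (K J) ∧
        (K J).card = (carrier J).card := by
      intro J hJ
      have hsub : J ⊆ H := by
        rw [(hcomp hJ).2]
        exact restrict_subset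
      refine ih J hJ (hH.mono hsub) ?_
      rw [(hcomp hJ).2]
      exact hA.restrict _
    have htube : ∀ {J}, J ∈ components H → ∀ {S}, S ∈ tubes J ↔ IsTube H S ∧ S ⊆ carrier J := by
      intro J hJ S
      rw [mem_tubes]
      conv_lhs => rw [(hcomp hJ).2]
      exact isTube_restrict hA (hcomp hJ).1.2.1
    have hmem : ∀ {J}, J ∈ components H → ∀ {U}, U ∈ K J → IsTube H U ∧ U ⊆ carrier J :=
      fun hJ _ hU => (htube hJ).1 ((hspan hJ).1.1.1 hU)
    have hdisj : ∀ {J J'}, J ∈ components H → J' ∈ components H →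
        ¬ Disjoint (carrier J) (carrier J') → J = J' := by
      intro J J' hJ hJ' hd
      rw [(hcomp hJ).2, (hcomp hJ').2, (hcomp hJ).1.eq_of_not_disjoint (hcomp hJ').1 hd]
    refine ⟨⟨⟨?_, fun M hM hW => ?_⟩, fun T hT => ?_⟩, ?_⟩
    · exact Finset.biUnion_subset.2 fun J hJ U hU => mem_tubes.2 (hmem hJ hU).1
    -- A union that is a tube lies in one component, so all the members involved come from the
    -- construction of that component.
    · obtain ⟨C, hC, hWC⟩ := hB.exists_component hW (hB.subset hW)
      have hJ : restrict H C ∈ components H := (mem_components hH hA).2 ⟨C, hC, rfl⟩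
      have hcar := carrier_restrict hA hC.2.1
      refine (hspan hJ).1.1.2 M (fun U hU => ?_) ((htube hJ).2 ⟨mem_tubes.1 hW, by rwa [hcar]⟩)
      obtain ⟨J', hJ', hUJ'⟩ := Finset.mem_biUnion.1 (hM hU)
      have hUC : U ⊆ C := (Finset.le_sup (f := id) hU).trans hWC
      obtain ⟨z, hz⟩ := (hmem hJ' hUJ').1.1
      rwa [hdisj hJ hJ' (by
        rw [hcar]
        exact not_disjoint_of_mem (hUC hz) ((hmem hJ' hUJ').2 hz))]
    · have hJ : restrict H T ∈ components H := (mem_components hH hA).2 ⟨T, hT, rfl⟩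
      have hcar := carrier_restrict hA hT.2.1
      refine Finset.mem_biUnion.2 ⟨_, hJ, ?_⟩
      have := carrier_mem_of_isTube (hspan hJ).1 (mem_tubes.1 ((htube hJ).2
        ⟨by rw [hcar]; exact mem_tubes.1 hT.1, subset_rfl⟩))
      rwa [hcar] at this
    · rw [Finset.card_biUnion, Finset.sum_congr rfl fun J hJ => (hspan hJ).2,
        ← Finset.card_biUnion]
      · congr 1
        ext z
        rw [Finset.mem_biUnion]
        constructor
        · rintro ⟨J, hJ, hz⟩
          exact (hcomp hJ).1.2.1 hz
        · intro hz
          obtain ⟨C, hC, hzC⟩ := hB.exists_component_of_mem subset_rfl hz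
          exact ⟨_, (mem_components hH hA).2 ⟨C, hC, rfl⟩, by rwa [carrier_restrict hA hC.2.1]⟩
      · intro J hJ J' hJ' hne
        by_contra hd
        exact hne (hdisj hJ hJ' hd)
      · intro J hJ J' hJ' hne
        refine Finset.disjoint_left.2 fun U hU hU' => hne (hdisj hJ hJ' ?_)
        obtain ⟨z, hz⟩ := (hmem hJ hU).1.1
        exact not_disjoint_of_mem ((hmem hJ hU).2 hz) ((hmem hJ' hU').2 hz)

/-- The part of a maximal nested set below `Y` is maximal when it contains enough members. -/
theorem spanningNested_restrict (hA : IsAtomic H) (hN : SpanningNested (tubes H) (carrier H) N)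
    (hY : Y ⊆ carrier H) (h : ∀ T, IsComponent (tubes H) Y T → T ∈ N) :
    SpanningNested (tubes (restrict H Y)) (carrier (restrict H Y)) (N.filter (· ⊆ Y)) := by
  rw [carrier_restrict hA hY]
  have htube : ∀ {S}, S ∈ tubes (restrict H Y) ↔ S ∈ tubes H ∧ S ⊆ Y := fun {S} => by
    rw [mem_tubes, mem_tubes, isTube_restrict hA hY]
  refine ⟨⟨fun U hU => ?_, fun M hM hW => ?_⟩, fun T hT => ?_⟩
  · rw [Finset.mem_filter] at hU
    exact htube.2 ⟨hN.1.1 hU.1, hU.2⟩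
  · exact hN.1.2 M (hM.trans (Finset.filter_subset _ _)) (htube.1 hW).1
  · rw [isComponent_restrict hA hY] at hT
    exact Finset.mem_filter.2 ⟨h T hT, hT.2.1⟩

/-- Induction on the size of the carrier. In the connected case the carrier is in `N`, and removing
it together with one of its labels leaves a smaller instance; otherwise `N` splits along the
components. -/
theorem isConstruction_of_spanningNested (hH : IsHypergraph H) (hA : IsAtomic H)
    (hN : SpanningNested (tubes H) (carrier H) N) (hcard : N.card = (carrier H).card) :
    IsConstruction H N := by
  induction h : (carrier H).card using Nat.strong_induction_on generalizing H N with
  | _ k ih =>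
  have hB := isBuildingSet_tubes H
  rcases (carrier H).eq_empty_or_nonempty with hempty | hne
  · have hN0 : N = ∅ := Finset.card_eq_zero.1 (by rw [hcard, hempty, Finset.card_empty])
    have hH0 : H = ∅ := by
      refine Finset.eq_empty_of_forall_notMem fun X hX => ?_
      exact (hH.nonempty hX).ne_empty (Finset.subset_empty.1 (hempty ▸ subset_carrier hX))
    subst hN0 hH0
    exact .empty
  by_cases hconn : Connected H
  · have htube := (connected_iff hH hA hne).1 hconn
    have hV := carrier_mem_of_isTube hN htube
    obtain ⟨x, hx⟩ := hN.1.label_nonempty hV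
    have hxV := (mem_label.1 hx).1
    have hsub : carrier H \ {x} ⊆ carrier H := Finset.sdiff_subset
    have hcomp : ∀ T, IsComponent (tubes H) (carrier H \ {x}) T → T ∈ N := by
      intro T hT
      by_contra hTN
      -- Adding a missing component would give a nested set with more than `|V|` members.
      have := (hN.of_subset (Finset.subset_insert T N)
        (hN.1.insert_component hB hV hx hT)).card_le hB
      rw [Finset.card_insert_of_notMem hTN] at this
      omega
    have hspan := spanningNested_restrict hA hN hsub hcomp
    have hfil : N.filter (· ⊆ carrier H \ {x}) = N.erase (carrier H) := by
      ext U
      rw [Finset.mem_filter, Finset.mem_erase, and_comm, and_congr_left_iff]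
      intro hU
      constructor
      · rintro hUx rfl
        simpa using hUx hxV
      · intro hne
        have hUV := hB.subset (hN.1.1 hU)
        exact Finset.subset_sdiff.2 ⟨hUV, Finset.disjoint_singleton_right.2
          ((mem_label.1 hx).2 U hU (hUV.ssubset_of_ne hne))⟩
    rw [hfil] at hspan
    have hcar := carrier_restrict hA hsub
    have hcard1 : (carrier (restrict H (carrier H \ {x}))).card + 1 = (carrier H).card := by
      rw [hcar, Finset.sdiff_singleton_eq_erase, Finset.card_erase_add_one hxV]
    have hcard2 := Finset.card_erase_add_one hV
    have := ih _ (by omega) (hH.mono restrict_subset) (hA.restrict _) hspan (by omega) rfl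
    have := IsConstruction.connected hconn hxV this
    rwa [Finset.union_comm, ← Finset.insert_eq, Finset.insert_erase hV] at this
  · have hcomp : ∀ {J}, J ∈ components H → IsComponent (tubes H) (carrier H) (carrier J) ∧
        J = restrict H (carrier J) := by
      intro J hJ
      obtain ⟨C, hC, rfl⟩ := (mem_components hH hA).1 hJ
      rw [carrier_restrict hA hC.2.1]
      exact ⟨hC, rfl⟩
    have hdisj : ∀ {J J'}, J ∈ components H → J' ∈ components H →
        ¬ Disjoint (carrier J) (carrier J') → J = J' := by
      intro J J' hJ hJ' hd
      rw [(hcomp hJ).2, (hcomp hJ').2, (hcomp hJ).1.eq_of_not_disjoint (hcomp hJ').1 hd]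
    have hspan : ∀ {J}, J ∈ components H →
        SpanningNested (tubes J) (carrier J) (N.filter (· ⊆ carrier J)) := by
      intro J hJ
      have := spanningNested_restrict hA hN (hcomp hJ).1.2.1 (fun T hT => by
        obtain ⟨z, hz⟩ := hB.nonempty hT.1
        have := hT.2.2 _ (hcomp hJ).1.1 subset_rfl (not_disjoint_of_mem (hT.2.1 hz) hz)
        rw [hT.2.1.antisymm this]
        exact hN.2 _ (hcomp hJ).1)
      rwa [← (hcomp hJ).2] at this
    have hunion : N = (components H).biUnion fun J => N.filter (· ⊆ carrier J) := by
      ext U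
      simp only [Finset.mem_biUnion, Finset.mem_filter]
      constructor
      · intro hU
        obtain ⟨C, hC, hUC⟩ := hB.exists_component (hN.1.1 hU) (hB.subset (hN.1.1 hU))
        exact ⟨_, (mem_components hH hA).2 ⟨C, hC, rfl⟩, hU,
          by rwa [carrier_restrict hA hC.2.1]⟩
      · rintro ⟨J, -, hU, -⟩
        exact hU
    have hV : (carrier H) = (components H).biUnion carrier := by
      ext z
      rw [Finset.mem_biUnion]
      constructor
      · intro hz
        obtain ⟨C, hC, hzC⟩ := hB.exists_component_of_mem subset_rfl hz
        exact ⟨_, (mem_components hH hA).2 ⟨C, hC, rfl⟩, by rwa [carrier_restrict hA hC.2.1]⟩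
      · rintro ⟨J, hJ, hz⟩
        exact (hcomp hJ).1.2.1 hz
    have hle : ∀ J ∈ components H, (N.filter (· ⊆ carrier J)).card ≤ (carrier J).card :=
      fun J hJ => (hspan hJ).card_le (isBuildingSet_tubes J)
    have hsum : ∑ J ∈ components H, (N.filter (· ⊆ carrier J)).card =
        ∑ J ∈ components H, (carrier J).card := by
      rw [← Finset.card_biUnion, ← Finset.card_biUnion, ← hunion, ← hV, hcard]
      · intro J hJ J' hJ' hne
        by_contra hd
        exact hne (hdisj hJ hJ' hd)
      · intro J hJ J' hJ' hne
        refine Finset.disjoint_left.2 fun U hU hU' => hne (hdisj hJ hJ' ?_)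
        rw [Finset.mem_filter] at hU hU'
        obtain ⟨z, hz⟩ := hB.nonempty (hN.1.1 hU.1)
        exact not_disjoint_of_mem (hU.2 hz) (hU'.2 hz)
    -- Each piece is bounded by the size of its component and the totals agree, so every bound is
    -- attained.
    have heq := (Finset.sum_eq_sum_iff_of_le hle).1 hsum
    have htwo : 2 ≤ (carrier H).card := by
      by_contra hlt
      have hpos := hne.card_pos
      obtain ⟨x, hx⟩ := Finset.card_eq_one.1 (by omega : (carrier H).card = 1)
      refine hconn ((connected_iff hH hA hne).2 (mem_tubes.1 ?_))
      rw [hx]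
      exact hB.singleton (by simp [hx])
    rw [hunion]
    refine .disconnected htwo hconn _ fun J hJ => ?_
    have hsub : J ⊆ H := by
      rw [(hcomp hJ).2]
      exact restrict_subset
    have hJA : IsAtomic J := by
      rw [(hcomp hJ).2]
      exact hA.restrict _
    refine ih _ ?_ (hH.mono hsub) hJA (hspan hJ) (heq J hJ) rfl
    rw [← h]
    refine Finset.card_lt_card ((hcomp hJ).1.2.1.ssubset_of_ne fun hJV => hconn ?_)
    rw [connected_iff hH hA hne, ← hJV]
    exact mem_tubes.1 (hcomp hJ).1.1

theorem isConstruct_iff (hH : IsHypergraph H) (hA : IsAtomic H) :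
    IsConstruct H N ↔ SpanningNested (tubes H) (carrier H) N := by
  have hB := isBuildingSet_tubes H
  have hcomp : (∀ J ∈ components H, carrier J ∈ N) ↔
      ∀ T, IsComponent (tubes H) (carrier H) T → T ∈ N := by
    constructor
    · intro h T hT
      have := h _ ((mem_components hH hA).2 ⟨T, hT, rfl⟩)
      rwa [carrier_restrict hA hT.2.1] at this
    · intro h J hJ
      obtain ⟨C, hC, rfl⟩ := (mem_components hH hA).1 hJ
      rw [carrier_restrict hA hC.2.1]
      exact h C hC
  rw [IsConstruct, hcomp]
  constructor
  · rintro ⟨⟨K, hK, hNK⟩, h⟩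
    exact ⟨(hK.spanningNested hH hA).1.1.mono hNK, h⟩
  · intro hN
    obtain ⟨K, hNK, hK, hcard⟩ := hN.exists_maximal hB
    exact ⟨⟨K, isConstruction_of_spanningNested hH hA hK hcard, hNK⟩, hN.2⟩

end Tubes

/-! ### Graded posets and a criterion for abstract polytopes. -/

section GradedPosets

variable {P : Type u} [PartialOrder P]

/-- `ρ` is a grading of a partially ordered set by integers. -/
structure IsGrading (ρ : P → ℤ) : Prop where
  strictMono : StrictMono ρ
  exists_step : ∀ a b, a < b → ∃ c, a < c ∧ c ≤ b ∧ ρ c = ρ a + 1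

theorem IsGrading.Icc {ρ : P → ℤ} (hρ : IsGrading ρ) (F G : P) :
    IsGrading (fun X : Set.Icc F G => ρ X.1) where
  strictMono _ _ h := hρ.strictMono h
  exists_step a b h := by
    obtain ⟨c, hac, hcb, hc⟩ := hρ.exists_step a.1 b.1 h
    exact ⟨⟨c, a.2.1.trans hac.le, hcb.trans b.2.2⟩, hac, hcb, hc⟩

/-- A flag skips no rank: an intermediate element between two consecutive members would be
comparable with the whole flag, hence belong to it. -/
theorem IsGrading.image_flag {ρ : P → ℤ} (hρ : IsGrading ρ) {a b : P} (ha : IsBot a)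
    (hb : IsTop b) (s : Flag P) : ρ '' (s : Set P) = Set.Icc (ρ a) (ρ b) := by
  have hmem : ∀ c : P, (∀ x ∈ s, c ≤ x ∨ x ≤ c) → c ∈ s := by
    intro c hc
    have hchain : IsChain (· ≤ ·) (insert c (s : Set P)) :=
      s.chain_le.insert fun x hx _ => hc x hx
    have := s.max_chain' hchain (Set.subset_insert _ _)
    change c ∈ s.carrier
    rw [this]
    exact Set.mem_insert _ _
  have has : a ∈ s := hmem a fun x _ => .inl (ha x)
  have hbs : b ∈ s := hmem b fun x _ => .inr (hb x)
  have hmono := hρ.strictMono.monotone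
  apply subset_antisymm
  · rintro _ ⟨x, -, rfl⟩
    exact ⟨hmono (ha x), hmono (hb x)⟩
  · rintro k ⟨hak, hkb⟩
    induction k, hak using Int.leInduction with
    | base => exact ⟨a, has, rfl⟩
    | succ k hk ih =>
      obtain ⟨x, hx, hxk⟩ := ih (by omega)
      have hxb : x < b := (hb x).lt_of_ne (by rintro rfl; omega)
      -- `y` is the next member of the flag above `x`; subtracting `ρ a` makes the ranks natural
      -- numbers, so that a minimum exists.
      obtain ⟨y, ⟨hy, hxy⟩, hmin⟩ := WellFounded.has_min
        (InvImage.wf (fun y => (ρ y - ρ a).toNat) wellFounded_lt) {y | y ∈ s ∧ x < y} ⟨b, hbs, hxb⟩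
      obtain ⟨c, hxc, hcy, hc⟩ := hρ.exists_step x y hxy
      refine ⟨c, hmem c fun z hz => ?_, by omega⟩
      rcases s.le_or_le hx hz with h | h
      · rcases h.eq_or_lt with rfl | h
        · exact .inr hxc.le
        · left
          rcases s.le_or_le hy hz with h' | h'
          · exact hcy.trans h'
          · rcases h'.eq_or_lt with rfl | h'
            · exact hcy
            · have h1 := hρ.strictMono h'
              have h2 := hmono (ha z)
              refine absurd ?_ (hmin z ⟨hz, h⟩)
              simp only [InvImage]
              omega
      · exact .inr (h.trans hxc.le)

/-- The grading is injective on a flag and its image is the interval from `ρ a` to `ρ b`, so a flag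
has `ρ b - ρ a + 1` elements, which must equal the rank plus two. -/
theorem IsGrading.isPosetOfRank {ρ : P → ℤ} (hρ : IsGrading ρ) {a b : P} (ha : IsBot a)
    (hb : IsTop b) : IsPosetOfRank P (ρ b - ρ a - 1) where
  neg_one_le := by
    have := hρ.strictMono.monotone (ha b)
    omega
  exists_least := ⟨a, ha⟩
  exists_greatest := ⟨b, hb⟩
  flag_card s := by
    have himg := hρ.image_flag ha hb s
    have hinj : Set.InjOn ρ (s : Set P) := by
      intro x hx y hy h
      rcases s.le_or_le hx hy with h' | h'
      · exact h'.eq_of_not_lt fun hlt => (hρ.strictMono hlt).ne h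
      · exact (h'.eq_of_not_lt fun hlt => (hρ.strictMono hlt).ne h.symm).symm
    refine ⟨Set.Finite.of_finite_image (by rw [himg]; exact Set.finite_Icc _ _) hinj, ?_⟩
    have := hρ.strictMono.monotone (ha b)
    rw [← hinj.ncard_image, himg, ← Finset.coe_Icc, Set.ncard_coe_finset,
      Int.card_Icc]
    omega

theorem IsPosetOfRank.unique {r r' : ℤ} (h : IsPosetOfRank P r) (h' : IsPosetOfRank P r') :
    r = r' := by
  have s : Flag P := Classical.choice inferInstance
  have := (h.flag_card s).2
  have := (h'.flag_card s).2
  omega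

theorem IsGrading.isPosetOfRank_Icc {ρ : P → ℤ} (hρ : IsGrading ρ) {F G : P} (h : F ≤ G) :
    IsPosetOfRank (Set.Icc F G) (ρ G - ρ F - 1) :=
  (hρ.Icc F G).isPosetOfRank (a := ⟨F, le_rfl, h⟩) (b := ⟨G, h, le_rfl⟩)
    (fun X => X.2.1) (fun X => X.2.2)

theorem IsGrading.hasFaceRank_iff {ρ : P → ℤ} (hρ : IsGrading ρ) {a : P} (ha : IsBot a)
    (hρa : ρ a = -1) (F : P) (k : ℤ) : HasFaceRank F k ↔ ρ F = k := by
  have key := hρ.isPosetOfRank_Icc (ha F)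
  rw [hρa] at key
  constructor
  · rintro ⟨a', ha', h⟩
    rw [(ha' a).antisymm (ha a')] at h
    have := h.unique key
    omega
  · rintro rfl
    refine ⟨a, ha, ?_⟩
    convert key using 1
    omega

/-- A graded partially ordered set is an abstract polytope as soon as its sections of rank at least
two are connected and its sections of rank one have four elements. -/
theorem IsGrading.isAbstractPolytope {ρ : P → ℤ} (hρ : IsGrading ρ) {a b : P} (ha : IsBot a)
    (hb : IsTop b) (hρa : ρ a = -1)
    (hconn : ∀ F G, F ≤ G → ρ F + 3 ≤ ρ G → ∀ X Y, F < X → X < G → F < Y → Y < G →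
      Relation.ReflTransGen (fun A B => (F < A ∧ A < G) ∧ (F < B ∧ B < G) ∧ Incident A B) X Y)
    (hdiam : ∀ F G, F ≤ G → ρ G = ρ F + 2 →
      {X : P | ρ X = ρ F + 1 ∧ F ≤ X ∧ X ≤ G}.ncard = 2) : IsAbstractPolytope P (ρ b) where
  rank := by
    convert hρ.isPosetOfRank ha hb using 1
    omega
  strongly_connected F G hFG := by
    have hmono := hρ.strictMono.monotone
    refine ⟨_, ?_, hρ.isPosetOfRank_Icc hFG, ?_⟩
    · have := hmono (ha F)
      have := hmono (hb G)
      omega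
    -- The section has rank `ρ G - ρ F - 1`, so rank above one means `ρ F + 3 ≤ ρ G`.
    · rw [IsConnectedOfRank, or_iff_not_imp_left]
      rintro hlt ⟨X, hX⟩ ⟨Y, hY⟩
      have hprop : ∀ Z : Set.Icc F G, IsProper Z ↔ F < Z.1 ∧ Z.1 < G := by
        intro Z
        have hbot : IsBot Z ↔ F = Z.1 :=
          ⟨fun h => le_antisymm Z.2.1 (h ⟨F, le_rfl, hFG⟩), fun h W => h.ge.trans W.2.1⟩
        have htop : IsTop Z ↔ Z.1 = G :=
          ⟨fun h => le_antisymm Z.2.2 (h ⟨G, hFG, le_rfl⟩), fun h W => W.2.2.trans h.ge⟩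
        rw [IsProper, hbot, htop, Z.2.1.lt_iff_ne, Z.2.2.lt_iff_ne]
      have hX' := (hprop X).1 hX
      have hY' := (hprop Y).1 hY
      have hpath := hconn F G hFG (by omega) X.1 Y.1 hX'.1 hX'.2 hY'.1 hY'.2
      have lift : ∀ W : P, Relation.ReflTransGen (fun A B => (F < A ∧ A < G) ∧ (F < B ∧ B < G) ∧
          Incident A B) X.1 W → ∀ hW : F < W ∧ W < G,
          Relation.ReflTransGen (fun A B : {Z : Set.Icc F G // IsProper Z} => Incident A.1 B.1)
            ⟨X, hX⟩ ⟨⟨W, hW.1.le, hW.2.le⟩, (hprop _).2 hW⟩ := by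
        intro W h
        induction h with
        | refl => exact fun _ => .refl
        | tail _ hlast ih => exact fun _ => .tail (ih hlast.1) hlast.2.2
      exact lift Y.1 hpath hY'
  diamond i _ _ F G hF hG hFG := by
    rw [hρ.hasFaceRank_iff ha hρa] at hF hG
    have := hdiam F G hFG (by omega)
    convert this using 3
    ext X
    rw [hρ.hasFaceRank_iff ha hρa, hF]
    simp

end GradedPosets

/-! ### The face poset: grading, connectedness of sections and the diamond condition. -/

section Faces

variable {α : Type u} [DecidableEq α] {H C D : Finset (Finset α)}

/-- The least face. -/
noncomputable def leastFace (H : Finset (Finset α)) : FacePoset H :=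
  ⟨Finset.insertNone (saturatedClosure H), .inr rfl⟩

/-- The face given by a construct. -/
def constructFace (h : IsConstruct H C) : FacePoset H :=
  ⟨C.map Function.Embedding.some, .inl ⟨C, h, rfl⟩⟩

theorem face_cases (F : FacePoset H) :
    F = leastFace H ∨ ∃ (C : Finset (Finset α)) (h : IsConstruct H C), F = constructFace h := by
  obtain ⟨F, hF⟩ := F
  rcases hF with ⟨C, hC, rfl⟩ | rfl
  · exact .inr ⟨C, hC, rfl⟩
  · exact .inl rfl

theorem constructFace_le {hC : IsConstruct H C} {hD : IsConstruct H D} :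
    constructFace hC ≤ constructFace hD ↔ D ⊆ C :=
  Finset.map_subset_map

theorem constructFace_lt {hC : IsConstruct H C} {hD : IsConstruct H D} :
    constructFace hC < constructFace hD ↔ D ⊂ C := by
  rw [lt_iff_le_not_ge, constructFace_le, constructFace_le]
  rfl

theorem constructFace_inj {hC : IsConstruct H C} {hD : IsConstruct H D} :
    constructFace hC = constructFace hD ↔ C = D := by
  rw [le_antisymm_iff, constructFace_le, constructFace_le, and_comm]
  exact Finset.Subset.antisymm_iff.symm

theorem none_notMem_constructFace {hC : IsConstruct H C} : none ∉ (constructFace hC).face := by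
  simp [constructFace]

theorem none_mem_leastFace : none ∈ (leastFace H).face := by
  simp [leastFace]

theorem isBot_leastFace (hH : IsHypergraph H) (hA : IsAtomic H) : IsBot (leastFace H) := by
  intro F
  rcases face_cases F with rfl | ⟨C, hC, rfl⟩
  · exact le_rfl
  · intro X hX
    obtain ⟨Y, hY, rfl⟩ := Finset.mem_map.1 hX
    exact Finset.some_mem_insertNone.2 (tubes_subset_saturatedClosure hH hA
      (((isConstruct_iff hH hA).1 hC).1.1 hY))

theorem leastFace_lt (hH : IsHypergraph H) (hA : IsAtomic H) (hC : IsConstruct H C) :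
    leastFace H < constructFace hC :=
  (isBot_leastFace hH hA _).lt_of_ne fun h =>
    none_notMem_constructFace (h ▸ none_mem_leastFace : none ∈ (constructFace hC).face)

/-- The rank of a face. -/
def faceRank (F : FacePoset H) : ℤ :=
  if none ∈ F.face then -1 else (carrier H).card - F.face.card

theorem faceRank_leastFace : faceRank (leastFace H) = -1 := if_pos none_mem_leastFace

theorem faceRank_constructFace (hC : IsConstruct H C) :
    faceRank (constructFace hC) = (carrier H).card - C.card := by
  rw [faceRank, if_neg none_notMem_constructFace]
  simp [constructFace]

theorem IsConstruct.of_subset (hC : IsConstruct H C) {E : Finset (Finset α)}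
    (hE : IsConstruct H E) (hCD : C ⊆ D) (hDE : D ⊆ E) : IsConstruct H D := by
  obtain ⟨⟨K, hK, hEK⟩, -⟩ := hE
  exact ⟨⟨K, hK, hDE.trans hEK⟩, fun J hJ => hCD (hC.2 J hJ)⟩

theorem isGrading_faceRank (hH : IsHypergraph H) (hA : IsAtomic H) :
    IsGrading (faceRank (H := H)) where
  strictMono F G hFG := by
    rcases face_cases G with rfl | ⟨D, hD, rfl⟩
    · exact absurd (isBot_leastFace hH hA F) hFG.not_ge
    · have hle := ((isConstruct_iff hH hA).1 hD).card_le (isBuildingSet_tubes H)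
      rcases face_cases F with rfl | ⟨C, hC, rfl⟩
      · rw [faceRank_leastFace, faceRank_constructFace]
        omega
      · rw [constructFace_lt] at hFG
        have := Finset.card_lt_card hFG
        rw [faceRank_constructFace, faceRank_constructFace]
        omega
  exists_step F G hFG := by
    rcases face_cases G with rfl | ⟨D, hD, rfl⟩
    · exact absurd (isBot_leastFace hH hA F) hFG.not_ge
    · rcases face_cases F with rfl | ⟨C, hC, rfl⟩
      -- Directly above the least face lie the constructions, of rank `0`; one of them contains `D`.
      · obtain ⟨K, hDK, hK, hcard⟩ :=
          ((isConstruct_iff hH hA).1 hD).exists_maximal (isBuildingSet_tubes H)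
        refine ⟨constructFace ((isConstruct_iff hH hA).2 hK), leastFace_lt hH hA _,
          constructFace_le.2 hDK, ?_⟩
        rw [faceRank_leastFace, faceRank_constructFace, hcard]
        omega
      · rw [constructFace_lt] at hFG
        obtain ⟨T, hT, hTD⟩ := Finset.exists_of_ssubset hFG
        have hsub : D ⊆ C.erase T := Finset.subset_erase.2 ⟨hFG.1, hTD⟩
        refine ⟨constructFace (hD.of_subset hC hsub (Finset.erase_subset T C)),
          constructFace_lt.2 (Finset.erase_ssubset hT), constructFace_le.2 hsub, ?_⟩
        rw [faceRank_constructFace, faceRank_constructFace, ← Finset.card_erase_add_one hT]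
        push_cast
        ring

/-- Incidence of proper faces of the section `G / F`. -/
def SectionAdj (F G A B : FacePoset H) : Prop :=
  (F < A ∧ A < G) ∧ (F < B ∧ B < G) ∧ Incident A B

/-- Both faces lie below facets `D ∪ {Tᵢ}` of `G`, so it suffices to join these. If `F` is a
construct, `D ∪ {T₁, T₂}` lies below both; if `F` is the least face, a path in the link of `D` is
followed. -/
theorem section_connected (hH : IsHypergraph H) (hA : IsAtomic H) (F G : FacePoset H)
    (hrank : faceRank F + 3 ≤ faceRank G) (X Y : FacePoset H)
    (hFX : F < X) (hXG : X < G) (hFY : F < Y) (hYG : Y < G) :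
    Relation.ReflTransGen (SectionAdj F G) X Y := by
  have hbot := isBot_leastFace hH hA
  rcases face_cases G with rfl | ⟨D, hD, rfl⟩
  · exact absurd (hbot X) hXG.not_ge
  rcases face_cases X with rfl | ⟨C₁, hC₁, rfl⟩
  · exact absurd (hbot F) hFX.not_ge
  rcases face_cases Y with rfl | ⟨C₂, hC₂, rfl⟩
  · exact absurd (hbot F) hFY.not_ge
  obtain ⟨T₁, hT₁, hT₁D⟩ := Finset.exists_of_ssubset (constructFace_lt.1 hXG)
  obtain ⟨T₂, hT₂, hT₂D⟩ := Finset.exists_of_ssubset (constructFace_lt.1 hYG)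
  have hsub₁ : insert T₁ D ⊆ C₁ := Finset.insert_subset hT₁ (constructFace_lt.1 hXG).1
  have hsub₂ : insert T₂ D ⊆ C₂ := Finset.insert_subset hT₂ (constructFace_lt.1 hYG).1
  have hI₁ := hD.of_subset hC₁ (Finset.subset_insert T₁ D) hsub₁
  have hI₂ := hD.of_subset hC₂ (Finset.subset_insert T₂ D) hsub₂
  have hlt : ∀ {T} (hI : IsConstruct H (insert T D)), T ∉ D → constructFace hI < constructFace hD :=
    fun _ hT => constructFace_lt.2 (Finset.ssubset_insert hT)
  have hF₁ : F < constructFace hI₁ := hFX.trans_le (constructFace_le.2 hsub₁)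
  have hF₂ : F < constructFace hI₂ := hFY.trans_le (constructFace_le.2 hsub₂)
  -- An edge of the link is a face below both of its ends, so it becomes a path of two incidences.
  have hedge : ∀ {S T} (hS : IsConstruct H (insert S D)) (hT : IsConstruct H (insert T D))
      (hST : IsConstruct H (insert S (insert T D))), S ∉ D → T ∉ D → F < constructFace hST →
      Relation.ReflTransGen (SectionAdj F (constructFace hD)) (constructFace hS)
        (constructFace hT) := by
    intro S T hS hT hST hSD hTD hF
    have h1 : constructFace hST ≤ constructFace hS :=
      constructFace_le.2 (Finset.insert_subset_insert _ (Finset.subset_insert _ _))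
    have h2 : constructFace hST ≤ constructFace hT :=
      constructFace_le.2 (Finset.subset_insert _ _)
    have hlt' : constructFace hST < constructFace hD := h1.trans_lt (hlt hS hSD)
    exact .tail (.single ⟨⟨hF.trans_le h1, hlt hS hSD⟩, ⟨hF, hlt'⟩, .inr h1⟩)
      ⟨⟨hF, hlt'⟩, ⟨hF.trans_le h2, hlt hT hTD⟩, .inl h2⟩
  suffices Relation.ReflTransGen (SectionAdj F (constructFace hD)) (constructFace hI₁)
      (constructFace hI₂) from
    (Relation.ReflTransGen.head ⟨⟨hFX, hXG⟩, ⟨hF₁, hlt _ hT₁D⟩, .inl (constructFace_le.2 hsub₁)⟩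
      this).tail ⟨⟨hF₂, hlt _ hT₂D⟩, ⟨hFY, hYG⟩, .inr (constructFace_le.2 hsub₂)⟩
  rw [faceRank_constructFace] at hrank
  rcases face_cases F with rfl | ⟨E, hE, rfl⟩
  · have hspan := (isConstruct_iff hH hA).1 hD
    rw [faceRank_leastFace] at hrank
    have hpath := hspan.link_connected (isBuildingSet_tubes H) (by omega) hT₁D
      ((isConstruct_iff hH hA).1 hI₁).1 hT₂D ((isConstruct_iff hH hA).1 hI₂).1
    have hcons : ∀ {M}, D ⊆ M → Nested (tubes H) M → IsConstruct H M :=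
      fun hDM hM => (isConstruct_iff hH hA).2 (hspan.of_subset hDM hM)
    have lift : ∀ T, Relation.ReflTransGen (LinkAdj (tubes H) D) T₁ T →
        ∀ hT : IsConstruct H (insert T D),
        Relation.ReflTransGen (SectionAdj (leastFace H) (constructFace hD)) (constructFace hI₁)
          (constructFace hT) := by
      intro T h
      induction h with
      | refl => exact fun _ => .refl
      | @tail S T _ hlast ih =>
        intro hT
        have hS := hcons (Finset.subset_insert S D)
          (hlast.2.mono (Finset.insert_subset_insert _ (Finset.subset_insert _ _)))
        exact (ih hS).trans (hedge hS hT
          (hcons ((Finset.subset_insert _ _).trans (Finset.subset_insert _ _)) hlast.2)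
          hlast.1.1 hlast.1.2 (leastFace_lt hH hA _))
    exact lift T₂ hpath hI₂
  · rw [faceRank_constructFace] at hrank
    rw [constructFace_lt] at hFX hFY
    have hsub : insert T₁ (insert T₂ D) ⊆ E :=
      Finset.insert_subset (hFX.1 hT₁) (hsub₂.trans hFY.1)
    have hI := hD.of_subset hE ((Finset.subset_insert _ _).trans (Finset.subset_insert _ _)) hsub
    -- The rank gap gives `|E| ≥ |D| + 3`, so adding two members to `D` does not reach `E`.
    refine hedge hI₁ hI₂ hI hT₁D hT₂D (constructFace_lt.2 (hsub.ssubset_of_ne fun h => ?_))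
    have h1 := Finset.card_insert_le T₁ (insert T₂ D)
    have h2 := Finset.card_insert_le T₂ D
    rw [h] at h1
    omega

theorem section_diamond (hH : IsHypergraph H) (hA : IsAtomic H) (F G : FacePoset H) (hFG : F ≤ G)
    (hrank : faceRank G = faceRank F + 2) :
    {X : FacePoset H | faceRank X = faceRank F + 1 ∧ F ≤ X ∧ X ≤ G}.ncard = 2 := by
  have hbot := isBot_leastFace hH hA
  rcases face_cases G with rfl | ⟨D, hD, rfl⟩
  · rw [hFG.antisymm (hbot F)] at hrank
    omega
  have hspan := (isConstruct_iff hH hA).1 hD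
  have hcons : ∀ {T}, Nested (tubes H) (insert T D) → IsConstruct H (insert T D) :=
    fun hM => (isConstruct_iff hH hA).2 (hspan.of_subset (Finset.subset_insert _ _) hM)
  -- Faces one rank below `D` are the constructs `D ∪ {T}`. Above a construct `E`, `T` ranges over
  -- the two elements of `E \ D`; above the least face, `|D| + 1 = |V|` and `T` is one of the two
  -- completions.
  suffices ∃ T₁ T₂, T₁ ≠ T₂ ∧ ∀ T, (T ∉ D ∧ ∃ hT : IsConstruct H (insert T D),
      F ≤ constructFace hT) ↔ T = T₁ ∨ T = T₂ by
    obtain ⟨T₁, T₂, hne, hiff⟩ := this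
    obtain ⟨hT₁D, hT₁, hFT₁⟩ := (hiff T₁).2 (.inl rfl)
    obtain ⟨hT₂D, hT₂, hFT₂⟩ := (hiff T₂).2 (.inr rfl)
    rw [faceRank_constructFace] at hrank
    rw [Set.ncard_eq_two]
    refine ⟨constructFace hT₁, constructFace hT₂, fun h => ?_, ?_⟩
    · rw [constructFace_inj] at h
      have := h ▸ Finset.mem_insert_self T₁ D
      rcases Finset.mem_insert.1 this with h | h
      · exact hne h
      · exact hT₁D h
    · ext X
      simp only [Set.mem_ofPred_eq, Set.mem_insert_iff, Set.mem_singleton_iff]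
      constructor
      · rintro ⟨hX, hFX, hXG⟩
        rcases face_cases X with rfl | ⟨C, hC, rfl⟩
        · rw [hFX.antisymm (hbot F)] at hX
          omega
        · rw [faceRank_constructFace] at hX
          obtain ⟨T, hT, rfl⟩ := Finset.exists_eq_insert_iff.2
            ⟨constructFace_le.1 hXG, (by omega : D.card + 1 = C.card)⟩
          rcases (hiff T).1 ⟨hT, hC, hFX⟩ with rfl | rfl
          · exact .inl rfl
          · exact .inr rfl
      · have hrk : ∀ {T} (hT : IsConstruct H (insert T D)), T ∉ D →
            faceRank (constructFace hT) = faceRank F + 1 := by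
          intro T hT hTD
          rw [faceRank_constructFace, Finset.card_insert_of_notMem hTD]
          push_cast
          omega
        rintro (rfl | rfl)
        · exact ⟨hrk hT₁ hT₁D, hFT₁, constructFace_le.2 (Finset.subset_insert _ _)⟩
        · exact ⟨hrk hT₂ hT₂D, hFT₂, constructFace_le.2 (Finset.subset_insert _ _)⟩
  rw [faceRank_constructFace] at hrank
  rcases face_cases F with rfl | ⟨E, hE, rfl⟩
  · rw [faceRank_leastFace] at hrank
    obtain ⟨T₁, T₂, hne, hiff⟩ := hspan.exists_two_completions (isBuildingSet_tubes H) (by omega)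
    refine ⟨T₁, T₂, hne, fun T => ?_⟩
    rw [← hiff]
    exact and_congr_right fun _ => ⟨fun h => ((isConstruct_iff hH hA).1 h.1).1,
      fun h => ⟨hcons h, hbot _⟩⟩
  · rw [faceRank_constructFace] at hrank
    rw [constructFace_le] at hFG
    have hcard : (E \ D).card = 2 := by
      rw [Finset.card_sdiff_of_subset hFG]
      omega
    obtain ⟨T₁, T₂, hne, hED⟩ := Finset.card_eq_two.1 hcard
    refine ⟨T₁, T₂, hne, fun T => ?_⟩
    have hmem : T ∈ E \ D ↔ T = T₁ ∨ T = T₂ := by simp [hED]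
    rw [← hmem, Finset.mem_sdiff, and_comm]
    refine and_congr_left fun _ => ⟨fun h => ?_, fun h => ?_⟩
    · exact constructFace_le.1 h.2 (Finset.mem_insert_self T D)
    · have hsub := Finset.insert_subset h hFG
      exact ⟨hD.of_subset hE (Finset.subset_insert _ _) hsub, constructFace_le.2 hsub⟩

theorem isAbstractPolytope_facePoset (hH : IsHypergraph H) (hA : IsAtomic H) :
    IsAbstractPolytope (FacePoset H) ((carrier H).card - connectednessNumber H) := by
  classical
  have hmem : ∀ T, T ∈ (tubes H).filter (IsComponent (tubes H) (carrier H)) ↔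
      IsComponent (tubes H) (carrier H) T := fun T => by
    rw [Finset.mem_filter, and_iff_right_iff_imp]
    exact fun h => h.1
  -- The maximal tubes by themselves form a construct, contained in every other one: the greatest
  -- face.
  have htop := (isConstruct_iff hH hA).2 (nested_components (isBuildingSet_tubes H) hmem)
  rw [connectednessNumber_eq_card hH hA hmem, ← faceRank_constructFace htop]
  refine (isGrading_faceRank hH hA).isAbstractPolytope (isBot_leastFace hH hA) (fun F => ?_)
    faceRank_leastFace (fun F G _ hrank X Y => section_connected hH hA F G hrank X Y)
    (section_diamond hH hA)
  rcases face_cases F with rfl | ⟨C, hC, rfl⟩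
  · exact isBot_leastFace hH hA _
  · exact constructFace_le.2 fun T hT => ((isConstruct_iff hH hA).1 hC).2 T ((hmem T).1 hT)

end Faces

end HypergraphPolytope

theorem proposition8p3 {α : Type*} [DecidableEq α] (H : Finset (Finset α))
    (hH : HypergraphPolytope.IsHypergraph H) (hA : HypergraphPolytope.IsAtomic H) :
    HypergraphPolytope.IsAbstractPolytope (HypergraphPolytope.FacePoset H)
      (((HypergraphPolytope.carrier H).card : ℤ) -
        (HypergraphPolytope.connectednessNumber H : ℤ)) :=
  HypergraphPolytope.isAbstractPolytope_facePoset hH hA
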